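/- **Corollary 2.** Let $N,T,L$ be positive integers with $N\ge F(T)+1$, where $F(T)=T+\lfloor T^2/4\rfloor+1$, and with $2\le L\le N/T$ and $L\mid T$. Put $\rho = 1-\left(1+\frac1L\right)\frac TN$ (so that $\rho N = N-T-T/L$ is an integer), and suppose that over some finite field there is a linear $[N,\rho N]$ code that is $L$-MDS. Let $\Sigma$ be a finite alphabet with $|\Sigma|\ge 2$. Then for every real $R$ with $\frac1{N-T}\le R\le\frac1{N-2T}$ and every real $D$ (in particular every such $D\le 1$) satisfying $$D\ \ge\ \frac{1-T/N-\rho(N-T)R}{N-T-\rho N}\,F(T)+\frac{\rho(N-T)R-\rho}{N-T-\rho N}\,LT\qquad\text{if } R\le \frac1{\rho N},$$ $$D\ \ge\ \frac{\rho-\rho(N-2T)R}{\rho N-(N-2T)}\,LT\qquad\text{if } R>\frac1{\rho N},$$ the pair $(R,D)$ is achievable for $T$-VPEC (variable packet-error coding) with $N$ packets over $\Sigma$. Equivalently, every point on or above the broken line through $\left(\frac1{N-T},\frac{F(T)}N\right)$, $\left(\frac1{\rho N},\frac{LT}N\right)$, $\left(\frac1{N-2T},0\right)$ is achievable. Here the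 notions are as follows. *$L$-MDS.* A linear $[n,k]$ code $\mathcal C\subseteq\mathbb F_q^n$ with $L\le\min\{q-1,\binom{n-1}{k-1}\}$ is $L$-MDS if for every $y\in\mathbb F_q^n$ the Hamming distances from $y$ of any $L+1$ distinct codewords of $\mathcal C$ sum to more than $L(n-k)$ (that is, $\mathcal C$ is strongly $(\tau,L)$-list decodable with $\tau=\frac{L(n-k)}{L+1}$). *Achievability.* A coding scheme of blocklength $k\ge1$ consists of encoders $f_\ell:\Sigma^k\to\Sigma^{m_\ell}$, $1\le \ell\le N$, and a decoder $g:\prod_{\ell}\Sigma^{m_\ell}\to(\Sigma\cup\{e\})^k$, where $e$ is an erasure symbol; the rate of packet $\ell$ is $\frac1k\log_{|\Sigma|}|\Sigma^{m_\ell}|=m_\ell/k$. The distortion $\Delta(x,\tilde x)$ of $x\in\Sigma^k$ and $\tilde x\in(\Sigma\cup\{e\})^k$ is the average over the coordinates of the values $0$ if $\tilde x_j=x_j$, $1$ if $\tilde x_j=e$, and $\infty$ otherwise. For an integer $t\ge 0$ let $D_t(f,g)$ be the maximum of $\Delta(x,g(y))$ over all $x\in\Sigma^k$ and all $y\in\prod_\ell\Sigma^{m_\ell}$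 that differ from $(f_1(x),\dots,f_N(x))$ in at most $t$ packets. The pair $(R,D)$ is achievable for $T$-VPEC if for every $\varepsilon>0$ there is, for some $k$, a coding scheme all of whose packets have rate at most $R+\varepsilon$ and for which $D_0(f,g)\le\varepsilon$ and $D_T(f,g)\le D+\varepsilon$. -/

import Mathlib

open scoped ENNReal

namespace VPEC

/-- Single-letter erasure distortion; the reconstruction alphabet is `Option α`,
with `none` as the erasure symbol. -/
noncomputable def symbolDistortion {α : Type*} [DecidableEq α] (x : α) : Option α → ℝ≥0∞
  | none => 1
  | some a => if a = x then 0 else ⊤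

/-- Erasure distortion of a block: the average of the single-letter distortions. -/
noncomputable def blockDistortion {α : Type*} [DecidableEq α] {k : ℕ}
    (x : Fin k → α) (y : Fin k → Option α) : ℝ≥0∞ :=
  (∑ j, symbolDistortion (x j) (y j)) / (k : ℝ≥0∞)

/-- An encoder-decoder pair for a source of blocklength `k` over the alphabet `α` and `N` packets;
packet `l` is a word of length `len l` over `α`. -/
structure CodingScheme (α : Type*) (N k : ℕ) where
  len : Fin N → ℕ
  enc : (l : Fin N) → (Fin k → α) → (Fin (len l) → α)
  dec : ((l : Fin N) → (Fin (len l) → α)) → (Fin k → Option α)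

/-- What the decoder receives when the source word is `x` and the packets in `A`
are replaced by those of `C`. -/
def CodingScheme.received {α : Type*} {N k : ℕ} (S : CodingScheme α N k) (x : Fin k → α)
    (A : Finset (Fin N)) (C : (l : Fin N) → (Fin (S.len l) → α)) :
    (l : Fin N) → (Fin (S.len l) → α) :=
  fun l => if l ∈ A then C l else S.enc l x

/-- Worst-case distortion under at most `T` packet errors. -/
noncomputable def CodingScheme.distortion {α : Type*} [DecidableEq α] {N k : ℕ}
    (S : CodingScheme α N k) (T : ℕ) : ℝ≥0∞ :=
  ⨆ (x : Fin k → α) (A : Finset (Fin N)) (_ : A.card ≤ T)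
    (C : (l : Fin N) → (Fin (S.len l) → α)),
    blockDistortion x (S.dec (S.received x A C))

/-- The rate of packet `l`: `1 / k` times the logarithm, to the base `|α|`, of the number of
values that the packet can take. -/
noncomputable def CodingScheme.rate {α : Type*} [Fintype α] {N k : ℕ}
    (S : CodingScheme α N k) (l : Fin N) : ℝ :=
  (1 / (k : ℝ)) * Real.logb (Fintype.card α : ℝ) (Fintype.card (Fin (S.len l) → α) : ℝ)

/-- Achievability of the rate-distortion vector `(R 1, …, R N, D₀, D₁)`
with respect to `(T₀, T₁)`. -/
def AchievableVector (α : Type*) [Fintype α] [DecidableEq α] {N : ℕ}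
    (R : Fin N → ℝ) (D₀ D₁ : ℝ) (T₀ T₁ : ℕ) : Prop :=
  ∀ ε : ℝ, 0 < ε → ∃ k : ℕ, 0 < k ∧ ∃ S : CodingScheme α N k,
    (∀ l, S.rate l ≤ R l + ε) ∧
    ((S.distortion T₀ : ℝ≥0∞) : EReal) ≤ ((D₀ + ε : ℝ) : EReal) ∧
    ((S.distortion T₁ : ℝ≥0∞) : EReal) ≤ ((D₁ + ε : ℝ) : EReal)

/-- Achievability of `(R, D)` for `T`-VPEC with `N` packets over the alphabet `α`: every packet has
rate `R`, reconstruction is lossless without errors, and the distortion is at most `D` under at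
most `T` packet errors. -/
def Achievable (α : Type*) [Fintype α] [DecidableEq α] (N T : ℕ) (R D : ℝ) : Prop :=
  AchievableVector α (fun _ : Fin N => R) 0 D 0 T

/-- Strong (average-radius) `(τ, L)`-list decodability: for every word `y`, the distances from `y`
of any `L + 1` distinct codewords sum to more than `(L + 1) τ`. -/
def StronglyListDecodable {α : Type*} [DecidableEq α] {n : ℕ} (C : Set (Fin n → α))
    (τ : ℚ) (L : ℕ) : Prop :=
  ∀ (y : Fin n → α) (W : Finset (Fin n → α)), (∀ c ∈ W, c ∈ C) → W.card = L + 1 →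
    ((L : ℚ) + 1) * τ < ((∑ c ∈ W, hammingDist y c : ℕ) : ℚ)

/-- The linear `[n, k]` code `C` over the finite field `F` is `L`-MDS: in the range
`L ≤ min {|F| - 1, (n - 1).choose (k - 1)}`, where strong `(τ, L)`-list decodability forces
`τ ≤ L (n - k) / (L + 1)`, it attains this bound. -/
def IsLMDS {F : Type*} [Field F] [Fintype F] [DecidableEq F] {n : ℕ}
    (C : Submodule F (Fin n → F)) (k L : ℕ) : Prop :=
  Module.finrank F C = k ∧ L + 1 ≤ Fintype.card F ∧ L ≤ (n - 1).choose (k - 1) ∧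
    StronglyListDecodable (C : Set (Fin n → F)) ((L : ℚ) * ((n : ℚ) - k) / ((L : ℚ) + 1)) L

/-- `F(T) = T + ⌊T² / 4⌋ + 1`. -/
def polytopeF (T : ℕ) : ℕ := T + T ^ 2 / 4 + 1

end VPEC

/-! The broken line has three corners, and time sharing (`Attains.convex`) fills the segments
between them, so one family of codes per corner suffices. In every family the packets are the
coordinates of interleaved MDS codewords. Call a source word a candidate if its packets differ from
the received tuple in at most T places. The decoder outputs what all candidates agree on and erases
the rest. Cyclically shifted systematic encoders make the fraction of lost symbols at most e/N when
the candidates disagree on at most e packets (`isErasureCode_of_blocks`).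

Corner 1/(N-2T): in dimension N-2T two candidates share an information set, so there is only one.

Corner 1/(ρN): in dimension K = ρN one has (L+1)T = L(N-K), exactly the list-decoding radius. The
L-MDS property survives interleaving (`IsLMDS.interleaved_sum_card_lt`), so there are at most L
candidates. Each differs from the received word in at most T packets, hence they disagree on at most
LT.

Corner 1/(N-T): a polytope code. The codewords are integral of dimension N-T, and each packet also
carries the Gram matrix of all packet vectors, whose length is negligible because it grows only
logarithmically with the number of interleaved rows. As 2T < N, all candidates have the same Gram
matrix. Join two packets when the received vectors violate it. The error set of a candidate covers
all edges. Each of its vertices has many neighbours outside it, since a vector with the right norm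
and the right inner products with N-T correct vectors is itself correct (`eq_of_inner_eq`). All such
tight covers together have at most F(T) vertices (`card_tightCovers_le`). -/

namespace VPEC

section Codes

open Finset

/-! ### Erasure codes, time sharing and achievability -/

/-- The positions in which two tuples differ. -/
noncomputable def diffSet {ι P : Type*} [Fintype ι] (x y : ι → P) : Finset ι := by
  classical exact univ.filter fun i => x i ≠ y i

theorem mem_diffSet {ι P : Type*} [Fintype ι] {x y : ι → P} {i : ι} :
    i ∈ diffSet x y ↔ x i ≠ y i := by
  classical simp [diffSet]

/-- The coordinates of the message that are not determined by a received tuple `y` with at most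
`T` packet errors. -/
noncomputable def ambiguous {ι α P : Type*} [Fintype ι] {N : ℕ} (enc : (ι → α) → Fin N → P)
    (T : ℕ) (y : Fin N → P) : Finset ι := by
  classical exact univ.filter fun j => ∃ x x', (diffSet (enc x) y).card ≤ T ∧
    (diffSet (enc x') y).card ≤ T ∧ x j ≠ x' j

theorem mem_ambiguous {ι α P : Type*} [Fintype ι] {N : ℕ} {enc : (ι → α) → Fin N → P}
    {T : ℕ} {y : Fin N → P} {j : ι} :
    j ∈ ambiguous enc T y ↔ ∃ x x', (diffSet (enc x) y).card ≤ T ∧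
    (diffSet (enc x') y).card ≤ T ∧ x j ≠ x' j := by
  classical simp [ambiguous]

/-- The encoder `enc` detects `T` packet errors, and `T` packet errors leave at most `e` message
coordinates undetermined. -/
structure IsErasureCode {ι α P : Type*} [Fintype ι] {N : ℕ} (enc : (ι → α) → Fin N → P)
    (T e : ℕ) : Prop where
  eq_of_close : ∀ x x', (diffSet (enc x) (enc x')).card ≤ T → x = x'
  card_ambiguous_le : ∀ y, (ambiguous enc T y).card ≤ e

/-- A received tuple is pulled back through a partial inverse of `ψ`. Symbols that no encoder
produces become arbitrary, which cannot create new errors. Injectivity on the used symbols is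
enough, so packet alphabets such as the integers may be infinite. -/
theorem IsErasureCode.comp_injOn {ι α P Q : Type*} [Fintype ι] [Nonempty P] {N T e : ℕ}
    {enc : (ι → α) → Fin N → P} (h : IsErasureCode enc T e) {ψ : P → Q}
    (hψ : Set.InjOn ψ {p | ∃ x i, enc x i = p}) :
    IsErasureCode (fun x i => ψ (enc x i)) T e := by
  refine ⟨fun x x' hx => h.eq_of_close x x' (le_trans (card_le_card ?_) hx), fun y => ?_⟩
  · intro i
    simp only [mem_diffSet]
    exact fun hi h' => hi (hψ ⟨x, i, rfl⟩ ⟨x', i, rfl⟩ h')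
  · refine le_trans (card_le_card ?_)
      (h.card_ambiguous_le fun i => Function.invFunOn ψ {p | ∃ x i, enc x i = p} (y i))
    have key : ∀ x, (diffSet (fun i => ψ (enc x i)) y).card ≤ T → (diffSet (enc x) fun i =>
        Function.invFunOn ψ {p | ∃ x i, enc x i = p} (y i)).card ≤ T := by
      refine fun x hx => le_trans (card_le_card ?_) hx
      intro i
      simp only [mem_diffSet]
      intro hi h'
      exact hi (by rw [← h', hψ.leftInvOn_invFunOn ⟨x, i, rfl⟩])
    intro j
    simp only [mem_ambiguous]
    rintro ⟨x, x', h1, h2, h3⟩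
    exact ⟨x, x', key x h1, key x' h2, h3⟩

theorem IsErasureCode.reindex {ι ι' α P : Type*} [Fintype ι] [Fintype ι'] {N T e : ℕ}
    {enc : (ι → α) → Fin N → P} (h : IsErasureCode enc T e) (σ : ι ≃ ι') :
    IsErasureCode (fun x : ι' → α => enc (fun j => x (σ j))) T e := by
  refine ⟨fun x x' hx => ?_, fun y => ?_⟩
  · have := h.eq_of_close _ _ hx
    funext j
    simpa using congrFun this (σ.symm j)
  · refine le_trans ?_ (h.card_ambiguous_le y)
    refine card_le_card_of_injOn σ.symm ?_ σ.symm.injective.injOn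
    intro j
    simp only [mem_coe, mem_ambiguous]
    rintro ⟨x, x', h1, h2, h3⟩
    exact ⟨_, _, h1, h2, by simpa using h3⟩

theorem IsErasureCode.sum {ι₁ ι₂ α P₁ P₂ : Type*} [Fintype ι₁] [Fintype ι₂] {N T e₁ e₂ : ℕ}
    {enc₁ : (ι₁ → α) → Fin N → P₁} {enc₂ : (ι₂ → α) → Fin N → P₂}
    (h₁ : IsErasureCode enc₁ T e₁) (h₂ : IsErasureCode enc₂ T e₂) :
    IsErasureCode (fun (x : ι₁ ⊕ ι₂ → α) i =>
      (enc₁ (fun j => x (Sum.inl j)) i, enc₂ (fun j => x (Sum.inr j)) i)) T (e₁ + e₂) := by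
  classical
  refine ⟨fun x x' hx => ?_, fun y => ?_⟩
  · have hl := h₁.eq_of_close (fun j => x (Sum.inl j)) (fun j => x' (Sum.inl j))
      (le_trans (card_le_card fun i => by simp only [mem_diffSet, ne_eq, Prod.mk.injEq]; tauto) hx)
    have hr := h₂.eq_of_close (fun j => x (Sum.inr j)) (fun j => x' (Sum.inr j))
      (le_trans (card_le_card fun i => by simp only [mem_diffSet, ne_eq, Prod.mk.injEq]; tauto) hx)
    funext j
    rcases j with j | j
    · exact congrFun hl j
    · exact congrFun hr j
  · have hsub : ambiguous (fun (x : ι₁ ⊕ ι₂ → α) i =>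
      (enc₁ (fun j => x (Sum.inl j)) i, enc₂ (fun j => x (Sum.inr j)) i)) T y ⊆
        (ambiguous enc₁ T fun i => (y i).1).disjSum (ambiguous enc₂ T fun i => (y i).2) := by
      have k₁ : ∀ x : ι₁ ⊕ ι₂ → α, (diffSet (fun i =>
          (enc₁ (fun j => x (Sum.inl j)) i, enc₂ (fun j => x (Sum.inr j)) i)) y).card ≤ T →
          (diffSet (enc₁ fun j => x (Sum.inl j)) fun i => (y i).1).card ≤ T :=
        fun x hx => le_trans (card_le_card fun i => by
          simp only [mem_diffSet, ne_eq, Prod.ext_iff]; tauto) hx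
      have k₂ : ∀ x : ι₁ ⊕ ι₂ → α, (diffSet (fun i =>
          (enc₁ (fun j => x (Sum.inl j)) i, enc₂ (fun j => x (Sum.inr j)) i)) y).card ≤ T →
          (diffSet (enc₂ fun j => x (Sum.inr j)) fun i => (y i).2).card ≤ T :=
        fun x hx => le_trans (card_le_card fun i => by
          simp only [mem_diffSet, ne_eq, Prod.ext_iff]; tauto) hx
      rintro (j | j) hj
      · obtain ⟨x, x', h1, h2, h3⟩ := mem_ambiguous.1 hj
        exact inl_mem_disjSum.2 (mem_ambiguous.2 ⟨_, _, k₁ x h1, k₁ x' h2, h3⟩)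
      · obtain ⟨x, x', h1, h2, h3⟩ := mem_ambiguous.1 hj
        exact inr_mem_disjSum.2 (mem_ambiguous.2 ⟨_, _, k₂ x h1, k₂ x' h2, h3⟩)
    refine le_trans (card_le_card hsub) ?_
    rw [card_disjSum]
    exact add_le_add (h₁.card_ambiguous_le _) (h₂.card_ambiguous_le _)

/-- There is an erasure code with `N` packets of length `len` for source words of length `k`. -/
def HasScheme (α : Type*) (N T k len e : ℕ) : Prop :=
  ∃ enc : (Fin k → α) → Fin N → (Fin len → α), IsErasureCode enc T e

theorem IsErasureCode.hasScheme {ι κ α P : Type*} [Fintype ι] [Fintype κ] [Nonempty P]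
    {N T e k len : ℕ} {enc : (ι → α) → Fin N → P} (h : IsErasureCode enc T e)
    {ψ : P → κ → α} (hψ : Set.InjOn ψ {p | ∃ x i, enc x i = p}) (hk : Fintype.card ι = k)
    (hlen : Fintype.card κ = len) : HasScheme α N T k len e := by
  have h' := (h.comp_injOn hψ).reindex (Fintype.equivFinOfCardEq hk)
  let τ := (Fintype.equivFinOfCardEq hlen).arrowCongr (Equiv.refl α)
  have : Nonempty (κ → α) := ⟨ψ (Classical.arbitrary P)⟩
  exact ⟨_, h'.comp_injOn τ.injective.injOn⟩

theorem HasScheme.zero (α : Type*) (N T : ℕ) : HasScheme α N T 0 0 0 :=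
  ⟨fun _ _ => Fin.elim0, fun _ _ _ => funext fun j => j.elim0, fun _ => by simp [eq_empty_of_isEmpty]⟩

theorem HasScheme.add {α : Type*} [Nonempty α] {N T k₁ l₁ e₁ k₂ l₂ e₂ : ℕ}
    (h₁ : HasScheme α N T k₁ l₁ e₁) (h₂ : HasScheme α N T k₂ l₂ e₂) :
    HasScheme α N T (k₁ + k₂) (l₁ + l₂) (e₁ + e₂) := by
  obtain ⟨enc₁, h₁⟩ := h₁
  obtain ⟨enc₂, h₂⟩ := h₂
  exact (h₁.sum h₂).hasScheme (κ := Fin l₁ ⊕ Fin l₂)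
    (Equiv.sumArrowEquivProdArrow _ _ _).symm.injective.injOn (by simp) (by simp)

theorem HasScheme.nsmul {α : Type*} [Nonempty α] {N T k l e : ℕ}
    (h : HasScheme α N T k l e) (p : ℕ) : HasScheme α N T (p * k) (p * l) (p * e) := by
  induction p with
  | zero => simpa using HasScheme.zero α N T
  | succ p ih => simpa only [Nat.succ_mul] using ih.add h

/-- The decoder that reproduces the determined coordinates and erases the others. -/
theorem IsErasureCode.exists_decoder {ι α P : Type*} [Fintype ι] {N T e : ℕ}
    {enc : (ι → α) → Fin N → P} (h : IsErasureCode enc T e) :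
    ∃ dec : (Fin N → P) → ι → Option α, (∀ x, dec (enc x) = fun j => some (x j)) ∧
      ∀ x y, (diffSet (enc x) y).card ≤ T →
        ∃ E : Finset ι, E.card ≤ e ∧ ∀ j, dec y j = none ∧ j ∈ E ∨ dec y j = some (x j) := by
  classical
  -- Any candidate may be chosen, because all of them agree off the ambiguous set.
  let dec : (Fin N → P) → ι → Option α := fun y j =>
    if hx : ∃ x, (diffSet (enc x) y).card ≤ T then
      if j ∈ ambiguous enc T y then none else some (hx.choose j)
    else none
  have hdec : ∀ x y, (diffSet (enc x) y).card ≤ T → ∀ j,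
      dec y j = none ∧ j ∈ ambiguous enc T y ∨ j ∉ ambiguous enc T y ∧ dec y j = some (x j) := by
    intro x y hxy j
    have hx : ∃ x, (diffSet (enc x) y).card ≤ T := ⟨x, hxy⟩
    simp only [dec, dif_pos hx]
    by_cases hj : j ∈ ambiguous enc T y
    · left; simp [hj]
    · right
      simp only [hj, not_false_eq_true, if_false, true_and, Option.some.injEq]
      by_contra hne
      exact hj (mem_ambiguous.2 ⟨_, _, hx.choose_spec, hxy, hne⟩)
  refine ⟨dec, fun x => funext fun j => ?_, fun x y hxy =>
    ⟨ambiguous enc T y, h.card_ambiguous_le y, fun j => (hdec x y hxy j).imp id And.right⟩⟩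
  have h0 : (diffSet (enc x) (enc x)).card ≤ T := by
    have : diffSet (enc x) (enc x) = ∅ := by ext; simp [mem_diffSet]
    simp [this]
  rcases hdec x _ h0 j with ⟨_, hj⟩ | hj
  · obtain ⟨z, z', h1, h2, h3⟩ := mem_ambiguous.1 hj
    exact absurd (congrFun ((h.eq_of_close _ _ h1).trans (h.eq_of_close _ _ h2).symm) j) h3
  · exact hj.2

/-- `(R, D)` is a limit of the rate-erasure pairs of erasure codes. -/
def Attains (α : Type*) (N T : ℕ) (R D : ℝ) : Prop :=
  ∀ ε : ℝ, 0 < ε → ∃ k len e : ℕ, 0 < k ∧ HasScheme α N T k len e ∧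
    (len : ℝ) ≤ (R + ε) * k ∧ (e : ℝ) ≤ (D + ε) * k

theorem Attains.mono {α : Type*} {N T : ℕ} {R D D' : ℝ} (h : Attains α N T R D) (hD : D ≤ D') :
    Attains α N T R D' := by
  intro ε hε
  obtain ⟨k, len, e, hk, hs, h1, h2⟩ := h ε hε
  exact ⟨k, len, e, hk, hs, h1, h2.trans (by gcongr)⟩

/-- Time sharing. -/
theorem Attains.convex {α : Type*} [Nonempty α] {N T : ℕ} {R₁ D₁ R₂ D₂ : ℝ}
    (h₁ : Attains α N T R₁ D₁) (h₂ : Attains α N T R₂ D₂) {c : ℝ} (h0 : 0 ≤ c) (h1 : c ≤ 1) :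
    Attains α N T (c * R₁ + (1 - c) * R₂) (c * D₁ + (1 - c) * D₂) := by
  intro ε hε
  obtain ⟨k₁, l₁, e₁, hk₁, hs₁, hl₁, he₁⟩ := h₁ (ε / 2) (by positivity)
  obtain ⟨k₂, l₂, e₂, hk₂, hs₂, hl₂, he₂⟩ := h₂ (ε / 2) (by positivity)
  obtain ⟨n, hn⟩ := exists_nat_ge ((|R₁ - R₂| + |D₁ - D₂|) / (ε / 2))
  rw [div_le_iff₀ (by positivity)] at hn
  set n' := n + 1
  -- Out of `n'` rounds, `a` use the first scheme. Rounding shifts the total by at most the gap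
  -- between the two values, and `n` was chosen so that `n * (ε / 2)` absorbs it.
  set a := ⌊c * n'⌋₊
  have hn'0 : (0 : ℝ) ≤ n' := by positivity
  have ha1 : (a : ℝ) ≤ c * n' := Nat.floor_le (by positivity)
  have ha2 : c * n' < a + 1 := Nat.lt_floor_add_one _
  have han : a ≤ n' := by
    have : (a : ℝ) ≤ n' := ha1.trans (by nlinarith)
    exact_mod_cast this
  obtain ⟨b, hb⟩ := Nat.exists_eq_add_of_le han
  have hbR : (b : ℝ) = n' - a := by rw [hb]; push_cast; ring
  have hnn : (n : ℝ) ≤ n' := by simp [n']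
  have aux : ∀ X₁ X₂ Y₁ Y₂ : ℝ, Y₁ ≤ (X₁ + ε / 2) * k₁ → Y₂ ≤ (X₂ + ε / 2) * k₂ →
      |X₁ - X₂| ≤ n * (ε / 2) →
      a * k₂ * Y₁ + b * k₁ * Y₂ ≤ (c * X₁ + (1 - c) * X₂ + ε) * (n' * k₁ * k₂) := by
    intro X₁ X₂ Y₁ Y₂ hY₁ hY₂ hX
    have e1 : (a : ℝ) * k₂ * Y₁ ≤ a * k₂ * ((X₁ + ε / 2) * k₁) := by gcongr
    have e2 : (b : ℝ) * k₁ * Y₂ ≤ b * k₁ * ((X₂ + ε / 2) * k₂) := by gcongr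
    have e3 : (a - c * n') * (X₁ - X₂) ≤ n' * (ε / 2) := by
      calc (a - c * n') * (X₁ - X₂) ≤ |(a - c * n') * (X₁ - X₂)| := le_abs_self _
        _ = |a - c * n'| * |X₁ - X₂| := abs_mul _ _
        _ ≤ 1 * (n * (ε / 2)) := by
          gcongr
          rw [abs_le]; constructor <;> linarith
        _ ≤ n' * (ε / 2) := by rw [one_mul]; gcongr
    have e4 : (a : ℝ) * (X₁ + ε / 2) + b * (X₂ + ε / 2) ≤
        (c * X₁ + (1 - c) * X₂ + ε) * n' := by rw [hbR]; linarith
    have e5 : (0 : ℝ) ≤ k₁ * k₂ := by positivity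
    nlinarith [mul_le_mul_of_nonneg_right e4 e5]
  refine ⟨a * k₂ * k₁ + b * k₁ * k₂, a * k₂ * l₁ + b * k₁ * l₂, a * k₂ * e₁ + b * k₁ * e₂, ?_,
    (hs₁.nsmul _).add (hs₂.nsmul _), ?_, ?_⟩
  · have : a * k₂ * k₁ + b * k₁ * k₂ = n' * (k₁ * k₂) := by rw [hb]; ring
    rw [this]; positivity
  all_goals
    have hk : (a : ℝ) * k₂ * k₁ + b * k₁ * k₂ = n' * k₁ * k₂ := by rw [hbR]; ring
    push_cast
    rw [hk]
    refine aux _ _ _ _ (by assumption) (by assumption) ?_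
    linarith [abs_nonneg (R₁ - R₂), abs_nonneg (D₁ - D₂)]

theorem Attains.achievable {α : Type*} [Fintype α] [DecidableEq α] (hα : 2 ≤ Fintype.card α)
    {N T : ℕ} {R D : ℝ} (h : Attains α N T R D) : Achievable α N T R D := by
  intro ε hε
  obtain ⟨k, len, e, hk, ⟨enc, henc⟩, hl, he⟩ := h ε hε
  obtain ⟨dec, hd0, hdT⟩ := henc.exists_decoder
  have hk0 : (0 : ℝ) < k := by exact_mod_cast hk
  refine ⟨k, hk, ⟨fun _ => len, fun l x => enc x l, dec⟩, fun l => ?_, ?_, ?_⟩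
  · have hb : (1 : ℝ) < Fintype.card α := by exact_mod_cast hα
    have : Real.logb (Fintype.card α : ℝ) ((Fintype.card α : ℝ) ^ len) = len := by
      rw [Real.logb_pow, Real.logb_self_eq_one hb, mul_one]
    simp only [CodingScheme.rate, Fintype.card_fun, Fintype.card_fin, Nat.cast_pow, this]
    rw [one_div, inv_mul_le_iff₀ hk0]
    linarith
  · have : CodingScheme.distortion (⟨fun _ => len, fun l x => enc x l, dec⟩ :
        CodingScheme α N k) 0 = 0 := by
      simp only [CodingScheme.distortion, ENNReal.iSup_eq_zero]
      intro x A hA C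
      have hA : A = ∅ := by simpa using hA
      have hr : CodingScheme.received (⟨fun _ => len, fun l x => enc x l, dec⟩ :
        CodingScheme α N k) x A C = enc x := by
        funext l; simp [CodingScheme.received, hA]
      rw [hr]
      simp [hd0, blockDistortion, symbolDistortion]
    rw [this]
    simpa using hε.le
  · have : CodingScheme.distortion (⟨fun _ => len, fun l x => enc x l, dec⟩ :
        CodingScheme α N k) T ≤ ENNReal.ofReal (D + ε) := by
      simp only [CodingScheme.distortion, iSup_le_iff]
      intro x A hA C
      set y := CodingScheme.received (⟨fun _ => len, fun l x => enc x l, dec⟩ :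
        CodingScheme α N k) x A C with hy
      have hxy : (diffSet (enc x) y).card ≤ T := by
        refine le_trans (card_le_card fun i hi => ?_) hA
        by_contra hiA
        exact mem_diffSet.1 hi (by simp [hy, CodingScheme.received, hiA])
      obtain ⟨E, hE, hdE⟩ := hdT x y hxy
      have hsum : ∑ j, symbolDistortion (x j) (dec y j) ≤ (e : ℝ≥0∞) := by
        calc ∑ j, symbolDistortion (x j) (dec y j) ≤ ∑ j, if j ∈ E then 1 else 0 := by
              refine sum_le_sum fun j _ => ?_
              rcases hdE j with ⟨h1, h2⟩ | h1
              · simp [h1, h2, symbolDistortion]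
              · simp [h1, symbolDistortion]
          _ = (E.card : ℝ≥0∞) := by simp
          _ ≤ e := by exact_mod_cast hE
      refine ENNReal.div_le_of_le_mul (hsum.trans ?_)
      rw [← ENNReal.ofReal_natCast k, ← ENNReal.ofReal_natCast e, ← ENNReal.ofReal_mul' hk0.le]
      exact ENNReal.ofReal_le_ofReal he
    -- No sign of `D` is assumed; it is the nonnegative erasure count that rules out truncation by
    -- `ENNReal.ofReal`.
    have hDε : 0 ≤ D + ε := by
      have : (0 : ℝ) ≤ (D + ε) * k := le_trans (by positivity) he
      exact nonneg_of_mul_nonneg_left this hk0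
    calc _ ≤ ((ENNReal.ofReal (D + ε) : ℝ≥0∞) : EReal) := EReal.coe_ennreal_le_coe_ennreal_iff.2 this
      _ = ((D + ε : ℝ) : EReal) := by rw [EReal.coe_ennreal_ofReal, max_eq_left hDε]

/-! ### Tight vertex covers and the bound F(T) -/

/-- The neighbours of `u` with respect to `Γ` outside `B`. -/
noncomputable def nbrsOutside {V : Type*} [Fintype V] (Γ : V → V → Prop) (B : Finset V) (u : V) : Finset V := by
  classical exact univ.filter fun v => v ∉ B ∧ Γ u v

theorem mem_nbrsOutside {V : Type*} [Fintype V] {Γ : V → V → Prop} {B : Finset V} {u v : V} :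
    v ∈ nbrsOutside Γ B u ↔ v ∉ B ∧ Γ u v := by
  classical simp [nbrsOutside]

/-- `B` is a vertex cover of `Γ` with at most `T` vertices, each of which has more than `T - |B|`
neighbours outside `B`. -/
structure IsTightCover {V : Type*} [Fintype V] (Γ : V → V → Prop) (T : ℕ) (B : Finset V) : Prop where
  card_le : B.card ≤ T
  cover : ∀ u v, Γ u v → u ∈ B ∨ v ∈ B
  lt_card_nbrs : ∀ u ∈ B, T < B.card + (nbrsOutside Γ B u).card

/-- AM-GM for the two factors a - s + 1 and s - 1. -/
theorem quarter_sq_bound_of_large (a s : ℕ) : s ≤ a → 1 ≤ s →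
    4 * (s + (a - s) * (s - 1)) ≤ a ^ 2 + 4 := by
  intro h1 h2
  obtain ⟨b, rfl⟩ := Nat.exists_eq_add_of_le h1
  obtain ⟨c, rfl⟩ := Nat.exists_eq_add_of_le h2
  simp only [Nat.add_sub_cancel_left]
  zify
  nlinarith [sq_nonneg ((b : ℤ) + 1 - c)]

/-- AM-GM for the two factors a - 1 and 1 + δ. -/
theorem quarter_sq_bound_of_small (a s δ : ℕ) (h1 : s ≤ a) (h2 : 1 ≤ s) :
    4 * (s + (a - s) * (1 + δ)) ≤ (a + δ) ^ 2 + 4 := by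
  obtain ⟨b, rfl⟩ := Nat.exists_eq_add_of_le h1
  obtain ⟨c, rfl⟩ := Nat.exists_eq_add_of_le h2
  simp only [Nat.add_sub_cancel_left]
  zify
  have h3 : (0 : ℤ) ≤ c * δ := by positivity
  nlinarith [sq_nonneg ((b : ℤ) + 1 + c - δ - 2)]

theorem quarter_sq_bound (a s δ : ℕ) (h1 : s ≤ a) (h2 : 1 ≤ s) :
    s + (a - s) * max (s - 1) (1 + δ) ≤ (a + δ) ^ 2 / 4 + 1 := by
  have : 4 * (s + (a - s) * max (s - 1) (1 + δ)) ≤ (a + δ) ^ 2 + 4 := by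
    rcases max_choice (s - 1) (1 + δ) with h | h <;> rw [h]
    · exact (quarter_sq_bound_of_large a s h1 h2).trans (by gcongr; omega)
    · exact quarter_sq_bound_of_small a s δ h1 h2
  omega

/-- A set function bound: if each member `S` of a family of subsets of `A` has at most `|S| + δ`
neighbours, and each point has more than `δ`, then the union of the family has few neighbours. -/
theorem card_biUnion_nbrs_le {V : Type*} [DecidableEq V] (A : Finset V) (n : V → Finset V) (δ : ℕ)
    (hn : ∀ u ∈ A, δ < (n u).card) (𝒮 : Finset (Finset V)) (h𝒮A : ∀ S ∈ 𝒮, S ⊆ A)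
    (h𝒮 : ∀ S ∈ 𝒮, (S.biUnion n).card ≤ S.card + δ) :
    ((𝒮.biUnion id).biUnion n).card ≤ δ + (A.card + δ) ^ 2 / 4 + 1 := by
  rcases 𝒮.eq_empty_or_nonempty with rfl | hne
  · simp
  obtain ⟨S₁, hS₁, hmax⟩ := exists_max_image 𝒮 card hne
  set s := S₁.card with hs
  rcases Nat.eq_zero_or_pos s with h0 | hpos
  · have : (𝒮.biUnion id).biUnion n = ∅ := by
      refine eq_empty_of_forall_notMem fun v hv => ?_
      simp only [mem_biUnion, id] at hv
      obtain ⟨u, ⟨S, hS, hu⟩, -⟩ := hv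
      have := hmax S hS
      rw [h0, Nat.le_zero, card_eq_zero] at this
      simp [this] at hu
    simp [this]
  -- Starting from a largest member `S₁` with at most `s + δ` neighbours, the other members are
  -- added one at a time; `m` bounds the number of new neighbours per new point.
  set m := max (s - 1) (1 + δ) with hm
  have hmain : ∀ 𝒲 : Finset (Finset V), 𝒲 ⊆ 𝒮 →
      ((S₁ ∪ 𝒲.biUnion id).biUnion n).card + s * m ≤
        s + δ + (S₁ ∪ 𝒲.biUnion id).card * m := by
    intro 𝒲
    induction 𝒲 using Finset.induction_on with
    | empty =>
      intro _
      simp only [biUnion_empty, union_empty]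
      have := h𝒮 S₁ hS₁
      rw [← hs] at this ⊢
      omega
    | insert S 𝒲 _ ih =>
      intro hsub
      have hS : S ∈ 𝒮 := hsub (mem_insert_self _ _)
      have ih := ih ((subset_insert _ _).trans hsub)
      set W := S₁ ∪ 𝒲.biUnion id with hW
      have hW' : S₁ ∪ (insert S 𝒲).biUnion id = W ∪ (S \ W) := by
        ext v
        simp only [hW, biUnion_insert, mem_union, mem_sdiff, id]
        tauto
      rw [hW', card_union_of_disjoint disjoint_sdiff]
      by_cases hSW : S ⊆ W
      · simp only [sdiff_eq_empty_iff_subset.2 hSW, union_empty, card_empty, add_zero]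
        exact ih
      have hpos : 1 ≤ (S \ W).card := card_pos.2 (sdiff_nonempty.2 hSW)
      have hdiff : (W ∪ S \ W).biUnion n ⊆ W.biUnion n ∪ (S.biUnion n \ W.biUnion n) := by
        intro v
        simp only [mem_biUnion, mem_union, mem_sdiff]
        rintro ⟨u, hu, hv⟩
        by_cases hvW : ∃ a ∈ W, v ∈ n a
        · exact Or.inl hvW
        · refine Or.inr ⟨⟨u, ?_, hv⟩, hvW⟩
          rcases hu with hu | hu
          · exact absurd ⟨u, hu, hv⟩ hvW
          · exact hu.1
      have hnew : (S.biUnion n \ W.biUnion n).card ≤ (S \ W).card * m := by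
        have hSn := h𝒮 S hS
        by_cases hdisj : Disjoint S W
        · rw [sdiff_eq_self_of_disjoint hdisj] at hpos ⊢
          have h1 : (S.biUnion n \ W.biUnion n).card ≤ (S.biUnion n).card :=
            card_le_card sdiff_subset
          have h2 : S.card * (1 + δ) ≤ S.card * m := Nat.mul_le_mul_left _ (le_max_right _ _)
          have h3 : δ ≤ S.card * δ := Nat.le_mul_of_pos_left _ hpos
          nlinarith
        -- A common point `u` has more than `δ` neighbours already counted, so `S` contributes at
        -- most `|S| - 1 ≤ s - 1` new ones.
        · obtain ⟨u, huS, huW⟩ := not_disjoint_iff.1 hdisj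
          have h1 : S.biUnion n \ W.biUnion n ⊆ S.biUnion n \ n u := by
            intro v
            simp only [mem_sdiff, mem_biUnion]
            exact fun h => ⟨h.1, fun hv => h.2 ⟨u, huW, hv⟩⟩
          have h2 : n u ⊆ S.biUnion n := subset_biUnion_of_mem n huS
          have h3 := card_le_card h1
          rw [card_sdiff_of_subset h2] at h3
          have h4 := hn u (h𝒮A S hS huS)
          have h5 := hmax S hS
          have h6 : s - 1 ≤ m := le_max_left _ _
          have h7 : m ≤ (S \ W).card * m := Nat.le_mul_of_pos_left _ hpos
          omega
      have h1 := card_le_card hdiff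
      have h2 := card_union_le (W.biUnion n) (S.biUnion n \ W.biUnion n)
      rw [add_mul]
      omega
  have hfin := hmain 𝒮 subset_rfl
  have hU : S₁ ∪ 𝒮.biUnion id = 𝒮.biUnion id :=
    union_eq_right.2 (subset_biUnion_of_mem id hS₁)
  rw [hU] at hfin
  have hUA : 𝒮.biUnion id ⊆ A := biUnion_subset.2 h𝒮A
  have hUA' : (𝒮.biUnion id).card * m ≤ A.card * m := Nat.mul_le_mul_right _ (card_le_card hUA)
  have hsA : s ≤ A.card := card_le_card (h𝒮A S₁ hS₁)
  have hq := quarter_sq_bound A.card s δ hsA hpos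
  rw [← hm, Nat.sub_mul] at hq
  have : s * m ≤ A.card * m := Nat.mul_le_mul_right _ hsA
  omega

/-- All tight covers of a graph together have at most `F(T)` vertices. -/
theorem card_tightCovers_le {V : Type*} [Fintype V] {Γ : V → V → Prop} (hΓ : ∀ u v, Γ u v → Γ v u) {T : ℕ} (E : Finset V)
    (hE : ∀ v ∈ E, ∃ B, IsTightCover Γ T B ∧ v ∈ B) : E.card ≤ polytopeF T := by
  classical
  rcases E.eq_empty_or_nonempty with rfl | ⟨v₀, hv₀⟩
  · simp
  obtain ⟨A, hA, -⟩ := hE v₀ hv₀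
  set 𝒮 : Finset (Finset V) := (univ.filter fun B => IsTightCover Γ T B).image fun B => A \ B
  obtain ⟨δ, hδ⟩ := Nat.exists_eq_add_of_le hA.card_le
  -- Relative to a fixed tight cover `A`, any other is determined by the part of `A` that it omits:
  -- a vertex of `B \ A` has a neighbour outside `B`, and the edge between them must be covered by
  -- `A`. Since `|B| ≤ T = |A| + δ`, this part `S` has at most `|S| + δ` neighbours outside `A`.
  have hBA : ∀ B, IsTightCover Γ T B → B \ A = (A \ B).biUnion (nbrsOutside Γ A) := by
    intro B hB
    ext v
    simp only [mem_sdiff, mem_biUnion, mem_nbrsOutside]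
    constructor
    · rintro ⟨hvB, hvA⟩
      have h1 := hB.lt_card_nbrs v hvB
      have h2 := hB.card_le
      obtain ⟨u, hu⟩ := card_pos.1 (show 0 < (nbrsOutside Γ B v).card by omega)
      rw [mem_nbrsOutside] at hu
      exact ⟨u, ⟨(hA.cover _ _ hu.2).resolve_left hvA, hu.1⟩, hvA, hΓ _ _ hu.2⟩
    · rintro ⟨u, ⟨huA, huB⟩, hvA, huv⟩
      exact ⟨(hB.cover _ _ huv).resolve_left huB, hvA⟩
  have hcard := card_biUnion_nbrs_le A (nbrsOutside Γ A) δ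
    (fun u hu => by have := hA.lt_card_nbrs u hu; omega) 𝒮
    (by
      intro S hS
      obtain ⟨B, -, rfl⟩ := mem_image.1 hS
      exact sdiff_subset)
    (by
      intro S hS
      obtain ⟨B, hB, rfl⟩ := mem_image.1 hS
      have hB := (mem_filter.1 hB).2
      rw [← hBA B hB]
      have h1 := hB.card_le
      have h2 := card_sdiff_add_card_inter A B
      have h3 := card_sdiff_add_card_inter B A
      rw [inter_comm] at h3
      omega)
  have hsub : E ⊆ A ∪ (𝒮.biUnion id).biUnion (nbrsOutside Γ A) := by
    intro v hv
    obtain ⟨B, hB, hvB⟩ := hE v hv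
    by_cases hvA : v ∈ A
    · exact mem_union_left _ hvA
    · refine mem_union_right _ ?_
      have : v ∈ (A \ B).biUnion (nbrsOutside Γ A) := by
        rw [← hBA B hB]; exact mem_sdiff.2 ⟨hvB, hvA⟩
      refine biUnion_subset_biUnion_of_subset_left _ ?_ this
      exact subset_biUnion_of_mem id (mem_image_of_mem _ (mem_filter.2 ⟨mem_univ _, hB⟩))
  have h1 := card_le_card hsub
  have h2 := card_union_le A ((𝒮.biUnion id).biUnion (nbrsOutside Γ A))
  rw [← hδ] at hcard
  unfold polytopeF
  omega

/-! ### MDS codes -/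

/-- A linear `[n, k]` code is maximum distance separable. -/
structure IsMDS {F : Type*} [Field F] {n : ℕ} (C : Submodule F (Fin n → F)) (k : ℕ) : Prop where
  finrank_eq : Module.finrank F C = k
  eq_zero : ∀ c ∈ C, ∀ S : Finset (Fin n), k ≤ S.card → (∀ i ∈ S, c i = 0) → c = 0

section MDS

variable {F : Type*} [Field F] {n k : ℕ} {C : Submodule F (Fin n → F)}

theorem IsMDS.eq_of_agree (h : IsMDS C k) {c c' : Fin n → F} (hc : c ∈ C) (hc' : c' ∈ C)
    {S : Finset (Fin n)} (hS : k ≤ S.card) (hcc' : ∀ i ∈ S, c i = c' i) : c = c' :=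
  sub_eq_zero.1 <| h.eq_zero _ (C.sub_mem hc hc') S hS fun i hi => by simp [hcc' i hi]

/-- The systematic encoder of an MDS code for a given information set. -/
theorem IsMDS.exists_systematic (h : IsMDS C k) {p : Fin k → Fin n} (hp : Function.Injective p) :
    ∃ E : (Fin k → F) →ₗ[F] (Fin n → F), (∀ u, E u ∈ C) ∧ ∀ u j, E u (p j) = u j := by
  let f : C →ₗ[F] (Fin k → F) := (LinearMap.funLeft F F p).comp C.subtype
  have hf : Function.Injective f := by
    rw [← LinearMap.ker_eq_bot, LinearMap.ker_eq_bot']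
    intro c hc
    refine Subtype.ext (h.eq_zero c c.2 (univ.map ⟨p, hp⟩) (by simp) fun i hi => ?_)
    obtain ⟨j, -, rfl⟩ := mem_map.1 hi
    exact congrFun hc j
  let e := LinearEquiv.ofInjectiveOfFinrankEq f hf (by simp [h.finrank_eq])
  refine ⟨C.subtype.comp e.symm.toLinearMap, fun u => (e.symm u).2, fun u j => ?_⟩
  have : f (e.symm u) = u := e.apply_symm_apply u
  exact congrFun this j

/-- Each coordinate of an MDS code is a linear combination of the coordinates in `S`,
if `S` has at least `k` elements. -/
theorem IsMDS.exists_coeff (h : IsMDS C k) {S : Finset (Fin n)} (hS : k ≤ S.card) (i : Fin n) :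
    ∃ a : Fin n → F, ∀ c ∈ C, c i = ∑ j ∈ S, a j * c j := by
  classical
  obtain ⟨S', hS', hcard⟩ := exists_subset_card_eq hS
  let p : Fin k → Fin n := fun j => S'.equivFinOfCardEq hcard |>.symm j
  have hp : Function.Injective p :=
    Subtype.val_injective.comp (S'.equivFinOfCardEq hcard).symm.injective
  have hpS : ∀ j, p j ∈ S' := fun j => ((S'.equivFinOfCardEq hcard).symm j).2
  obtain ⟨E, hEC, hE⟩ := h.exists_systematic hp
  have himg : univ.map ⟨p, hp⟩ = S' :=
    eq_of_subset_of_card_le (fun i hi => by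
      obtain ⟨j, -, rfl⟩ := mem_map.1 hi; exact hpS j) (by simp [hcard])
  let a' : Fin k → F := fun j => E (fun l => if j = l then 1 else 0) i
  refine ⟨fun i => if i ∈ S' then ∑ j, if p j = i then a' j else 0 else 0, fun c hc => ?_⟩
  have hcE : c = E (fun j => c (p j)) := h.eq_of_agree hc (hEC _) (S := S') hcard.ge (by
    intro i hi
    rw [← himg] at hi
    obtain ⟨j, -, rfl⟩ := mem_map.1 hi
    exact (hE (fun j => c (p j)) j).symm)
  have h1 : c i = ∑ j, a' j * c (p j) := by
    conv_lhs => rw [hcE, LinearMap.pi_apply_eq_sum_univ E]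
    simp only [Finset.sum_apply, Pi.smul_apply, smul_eq_mul, a']
    refine sum_congr rfl fun j _ => ?_
    rw [mul_comm]
  have h2 : ∑ j ∈ S, (if j ∈ S' then ∑ j', if p j' = j then a' j' else 0 else 0) * c j =
      ∑ j ∈ S', (∑ j', if p j' = j then a' j' else 0) * c j := by
    rw [← sum_subset hS']
    · exact sum_congr rfl fun j hj => by rw [if_pos hj]
    · intro j _ hj; simp [hj]
  rw [h1, h2, ← himg, sum_map]
  refine sum_congr rfl fun j _ => ?_
  congr 1
  simp [hp.eq_iff]

end MDS

/-! ### List decoding of L-MDS codes and their interleavings -/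

section ListDecoding

variable {F : Type*} [Field F] [Fintype F] [DecidableEq F] {n k L : ℕ}
  {C : Submodule F (Fin n → F)}

theorem IsLMDS.sum_hammingDist (h : IsLMDS C k L) (hk : k ≤ n) (y : Fin n → F)
    (W : Finset (Fin n → F)) (hW : ∀ c ∈ W, c ∈ C) (hcard : W.card = L + 1) :
    L * (n - k) < ∑ c ∈ W, hammingDist y c := by
  have h1 := h.2.2.2 y W hW hcard
  have h2 : ((L : ℚ) + 1) * ((L : ℚ) * ((n : ℚ) - k) / ((L : ℚ) + 1)) = L * ((n : ℚ) - k) := by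
    have : (L : ℚ) + 1 ≠ 0 := by positivity
    field_simp
  rw [h2, ← Nat.cast_sub hk] at h1
  exact_mod_cast h1

/-- A nonzero codeword with `k` zeros would have `L` distinct nonzero multiples, as the field is
large enough. Together with 0 these lie too close to the zero word. -/
theorem IsLMDS.isMDS (h : IsLMDS C k L) (hk : k ≤ n) : IsMDS C k := by
  refine ⟨h.1, fun c hc S hS hcS => ?_⟩
  by_contra hne
  have hq : L ≤ ((univ : Finset F).erase 0).card := by
    have := h.2.1
    rw [card_erase_of_mem (mem_univ _), card_univ]; omega
  obtain ⟨A, hA, hAL⟩ := exists_subset_card_eq hq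
  have h0A : (0 : F) ∉ A := fun h => by simpa using hA h
  have hinj : Function.Injective fun a : F => a • c := smul_left_injective F hne
  have hlt := h.sum_hammingDist hk 0 ((insert 0 A).map ⟨_, hinj⟩) (by
    intro d hd
    obtain ⟨a, -, rfl⟩ := mem_map.1 hd
    exact C.smul_mem a hc) (by rw [card_map, card_insert_of_notMem h0A, hAL])
  rw [sum_map, sum_insert h0A] at hlt
  have hle : ∑ a ∈ A, hammingDist (0 : Fin n → F) (a • c) ≤ ∑ a ∈ A, (n - k) := by
    refine sum_le_sum fun a _ => ?_
    have hsub : (univ.filter fun i => (0 : Fin n → F) i ≠ (a • c) i) ⊆ univ \ S := by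
      intro i hi
      rw [mem_sdiff]
      refine ⟨mem_univ _, fun hiS => ?_⟩
      simp [hcS i hiS] at hi
    have := card_le_card hsub
    rw [card_sdiff_of_subset (subset_univ _), card_univ, Fintype.card_fin] at this
    exact this.trans (by omega)
  simp only [Function.Embedding.coeFn_mk, zero_smul, hammingDist_self, zero_add] at hlt
  rw [sum_const, smul_eq_mul, hAL] at hle
  omega

/-- The positions in which a word agrees with `y`. -/
def agreeSet {V : Type*} [DecidableEq V] (y c : Fin n → V) : Finset (Fin n) :=
  univ.filter fun i => c i = y i

theorem card_agreeSet_add {V : Type*} [DecidableEq V] (y c : Fin n → V) :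
    (agreeSet y c).card + hammingDist y c = n := by
  have := card_filter_add_card_filter_not (s := (univ : Finset (Fin n))) (fun i => c i = y i)
  rw [card_univ, Fintype.card_fin] at this
  simpa only [agreeSet, hammingDist, eq_comm] using this

/-- An `L`-MDS code has the same optimality for all smaller list sizes. -/
theorem IsLMDS.sum_card_agreeSet_lt (h : IsLMDS C k L) (hk : k ≤ n) (hLk : L ≤ k) :
    ∀ m w, w + m = L + 1 → 2 ≤ w → ∀ (y : Fin n → F) (W : Finset (Fin n → F)),
      (∀ c ∈ W, c ∈ C) → W.card = w → ∑ c ∈ W, (agreeSet y c).card + k < n + w * k := by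
  intro m
  have hmds := h.isMDS hk
  induction m with
  | zero =>
    intro w hw hw2 y W hW hcard
    have h1 := h.sum_hammingDist hk y W hW (by omega)
    have h2 : ∑ c ∈ W, ((agreeSet y c).card + hammingDist y c) = (L + 1) * n := by
      rw [sum_congr rfl fun c _ => card_agreeSet_add y c, sum_const, smul_eq_mul, hcard]
      congr 1
    rw [sum_add_distrib] at h2
    obtain ⟨r, rfl⟩ := Nat.exists_eq_add_of_le hk
    rw [Nat.add_sub_cancel_left] at h1
    obtain rfl : w = L + 1 := by omega
    nlinarith
  | succ m ih =>
    intro w hw hw2 y W hW hcard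
    by_contra! hcon
    -- If `y` is itself in the list, every other member agrees with it in fewer than `k` places and
    -- the bound is direct.
    by_cases hy : y ∈ W
    · have h1 : ∀ c ∈ W.erase y, (agreeSet y c).card + 1 ≤ k := by
        intro c hc
        by_contra! hlt
        refine (mem_erase.1 hc).1 (hmds.eq_of_agree (hW c (mem_erase.1 hc).2) (hW y hy)
          (S := agreeSet y c) (by omega) fun i hi => ?_)
        simpa [agreeSet] using hi
      have h2 := sum_le_sum h1
      rw [sum_add_distrib, sum_const, sum_const, card_erase_of_mem hy, hcard, smul_eq_mul,
        smul_eq_mul] at h2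
      have h3 := add_sum_erase W (fun c => (agreeSet y c).card) hy
      have h4 := card_agreeSet_add y y
      rw [hammingDist_self] at h4
      obtain ⟨v, rfl⟩ := Nat.exists_eq_add_of_le hw2
      simp only [show 2 + v - 1 = v + 1 by omega] at h2
      nlinarith
    -- Otherwise a violating list is extended. Choose `k` positions that include a disagreement of
    -- each member with `y`, which is possible as `w ≤ L ≤ k`. The codeword interpolating `y` there
    -- is new and contributes at least `k` agreements, so the longer list violates the bound too.
    · have hmiss : ∀ c ∈ W, ∃ i, c i ≠ y i := by
        intro c hc
        by_contra! hall
        exact hy (funext hall ▸ hc)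
      obtain ⟨c₀, hc₀⟩ := card_pos.1 (show 0 < W.card by omega)
      have : Nonempty (Fin n) := ⟨(hmiss c₀ hc₀).choose⟩
      choose! g hg using hmiss
      obtain ⟨S, hS, -, hScard⟩ := exists_subsuperset_card_eq (n := k)
        (subset_univ (W.image g))
        (card_image_le.trans (by omega)) (by simpa using hk)
      let p : Fin k → Fin n := fun j => S.equivFinOfCardEq hScard |>.symm j
      have hp : Function.Injective p :=
        Subtype.val_injective.comp (S.equivFinOfCardEq hScard).symm.injective
      obtain ⟨E, hEC, hE⟩ := hmds.exists_systematic hp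
      set d := E (fun j => y (p j)) with hd
      have hdS : ∀ i ∈ S, d i = y i := by
        intro i hi
        have := hE (fun j => y (p j)) (S.equivFinOfCardEq hScard ⟨i, hi⟩)
        simpa [p] using this
      have hdW : d ∉ W := fun hdW =>
        hg d hdW (hdS _ (hS (mem_image_of_mem g hdW)))
      have := ih (w + 1) (by omega) (by omega) y (insert d W) (by
        intro c hc
        rcases mem_insert.1 hc with rfl | hc
        · exact hEC _
        · exact hW c hc) (by rw [card_insert_of_notMem hdW, hcard])
      rw [sum_insert hdW] at this
      have hSd : S ⊆ agreeSet y d := fun i hi => by simpa [agreeSet] using hdS i hi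
      have := card_le_card hSd
      rw [hScard] at this
      nlinarith

/-- Replacing `y` by a list member `d` outside the union of the agreement sets gives `d` an
agreement at each position there. Hence the length `n` drops to the size of the union, the form that
supports the induction for interleaved codes. -/
theorem IsLMDS.sum_card_lt (h : IsLMDS C k L) (hk : k ≤ n) (hLk : L ≤ k)
    (y : Fin n → F) (W : Finset (Fin n → F)) (hW : ∀ c ∈ W, c ∈ C)
    (h2 : 2 ≤ W.card) (hL : W.card ≤ L + 1) (J : (Fin n → F) → Finset (Fin n))
    (hJ : ∀ c ∈ W, ∀ i ∈ J c, c i = y i) :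
    ∑ c ∈ W, (J c).card + k < (W.biUnion J).card + W.card * k := by
  obtain ⟨d, hd⟩ := card_pos.1 (show 0 < W.card by omega)
  let y' : Fin n → F := fun i => if i ∈ W.biUnion J then y i else d i
  have hmain := h.sum_card_agreeSet_lt hk hLk (L + 1 - W.card) W.card (by omega) h2 y' W hW rfl
  have hsub : ∀ c ∈ W, J c ⊆ agreeSet y' c := by
    intro c hc i hi
    have : i ∈ W.biUnion J := mem_biUnion.2 ⟨c, hc, hi⟩
    simp only [agreeSet, mem_filter, mem_univ, true_and, y', if_pos this]
    exact hJ c hc i hi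
  have hsubd : J d ∪ (W.biUnion J)ᶜ ⊆ agreeSet y' d := by
    refine union_subset (hsub d hd) fun i hi => ?_
    rw [mem_compl] at hi
    simp only [agreeSet, mem_filter, mem_univ, true_and, y', if_neg hi]
  have hdisj : Disjoint (J d) (W.biUnion J)ᶜ :=
    disjoint_compl_right.mono_left (subset_biUnion_of_mem J hd)
  have h3 := card_le_card hsubd
  rw [card_union_of_disjoint hdisj, card_compl, Fintype.card_fin] at h3
  have h4 : ∑ c ∈ W.erase d, (J c).card ≤ ∑ c ∈ W.erase d, (agreeSet y' c).card :=
    sum_le_sum fun c hc => card_le_card (hsub c (mem_of_mem_erase hc))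
  rw [← add_sum_erase W _ hd] at hmain ⊢
  have h5 : (W.biUnion J).card ≤ n := by simpa using card_le_univ (W.biUnion J)
  omega

/-- The list-decoding property passes from an `L`-MDS code to its interleavings. -/
theorem IsLMDS.interleaved_sum_card_lt (h : IsLMDS C k L) (hk : k ≤ n) (hLk : L ≤ k)
    {τ : Type*} (y : Fin n → τ → F) :
    ∀ (w : ℕ) (W : Finset (Fin n → τ → F)), (∀ c ∈ W, ∀ t, (fun i => c i t) ∈ C) →
    W.card = w → 2 ≤ w → w ≤ L + 1 → ∀ (J : (Fin n → τ → F) → Finset (Fin n)),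
    (∀ c ∈ W, ∀ i ∈ J c, c i = y i) →
    ∑ c ∈ W, (J c).card + k < (W.biUnion J).card + w * k := by
  classical
  intro w
  induction w using Nat.strong_induction_on with
  | _ w ih =>
    intro W hW hcard hw2 hwL J hJ
    obtain ⟨a, ha, b, hb, hab⟩ := one_lt_card.1 (show 1 < W.card by omega)
    have : ∃ t, (fun i => a i t) ≠ fun i => b i t := by
      by_contra! hall
      exact hab (funext fun i => funext fun t => congrFun (hall t) i)
    obtain ⟨t, ht⟩ := this
    -- Group the list by a row that separates two of its members. The scalar bound applies to the
    -- unions of agreement sets over the groups, the induction hypothesis inside each group, and the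
    -- two add up.
    let π : (Fin n → τ → F) → Fin n → F := fun c i => c i t
    let D := W.image π
    let B : (Fin n → F) → Finset (Fin n → τ → F) := fun d => W.filter fun c => π c = d
    let J' : (Fin n → F) → Finset (Fin n) := fun d => (B d).biUnion J
    have hD2 : 2 ≤ D.card := one_lt_card.2
      ⟨π a, mem_image_of_mem _ ha, π b, mem_image_of_mem _ hb, ht⟩
    have hDL : D.card ≤ W.card := card_image_le
    have hscal := h.sum_card_lt hk hLk (fun i => y i t) D (by
      intro d hd
      obtain ⟨c, hc, rfl⟩ := mem_image.1 hd
      exact hW c hc t) hD2 (by omega) J' (by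
      intro d _ i hi
      obtain ⟨c, hc, hi⟩ := mem_biUnion.1 hi
      obtain ⟨hcW, rfl⟩ := mem_filter.1 hc
      exact congrFun (hJ c hcW i (by assumption)) t)
    have hJJ : D.biUnion J' ⊆ W.biUnion J := by
      intro i hi
      obtain ⟨d, _, hi⟩ := mem_biUnion.1 hi
      obtain ⟨c, hc, hi⟩ := mem_biUnion.1 hi
      exact mem_biUnion.2 ⟨c, (mem_filter.1 hc).1, hi⟩
    have hsumcard : ∑ d ∈ D, (B d).card = W.card :=
      (card_eq_sum_card_image π W).symm
    have hpos : ∀ d ∈ D, 1 ≤ (B d).card := by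
      intro d hd
      obtain ⟨c, hc, rfl⟩ := mem_image.1 hd
      exact card_pos.2 ⟨c, mem_filter.2 ⟨hc, rfl⟩⟩
    have hlt : ∀ d ∈ D, (B d).card < W.card := by
      intro d hd
      refine card_lt_card ((filter_subset _ _).ssubset_of_ne fun heq => ?_)
      have h1 : π a = d := (mem_filter.1 (heq.symm.subset ha)).2
      have h2 : π b = d := (mem_filter.1 (heq.symm.subset hb)).2
      exact ht (h1.trans h2.symm)
    have hfib : ∀ d ∈ D, ∑ c ∈ B d, (J c).card + k ≤ (J' d).card + (B d).card * k := by
      intro d hd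
      rcases (hpos d hd).eq_or_lt with h1 | h1
      · obtain ⟨c, hc⟩ := card_eq_one.1 h1.symm
        simp [J', hc]
      · refine (ih _ (hcard ▸ hlt d hd) (B d) (fun c hc => hW c (mem_filter.1 hc).1) rfl h1
          (by have := hlt d hd; omega) J (fun c hc => hJ c (mem_filter.1 hc).1)).le
    have hsum := sum_le_sum hfib
    rw [sum_add_distrib, sum_add_distrib, sum_const, smul_eq_mul, ← sum_mul, hsumcard,
      sum_fiberwise_of_maps_to (fun c hc => mem_image_of_mem π hc)] at hsum
    have := card_le_card hJJ
    rw [hcard] at hsum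
    omega

end ListDecoding

/-! ### From MDS codes to erasure codes: unique and list decoding -/

/-- Reed-Solomon codes. -/
theorem exists_isMDS {F : Type*} [Field F] {N K : ℕ} (hKN : K ≤ N) {v : Fin N → F}
    (hv : Function.Injective v) : ∃ C : Submodule F (Fin N → F), IsMDS C K := by
  let f : Polynomial F →ₗ[F] (Fin N → F) := LinearMap.pi fun i => Polynomial.leval (v i)
  have hf : ∀ p ∈ Polynomial.degreeLT F K, ∀ S : Finset (Fin N), K ≤ S.card →
      (∀ i ∈ S, f p i = 0) → p = 0 := by
    intro p hp S hS h0
    rw [Polynomial.mem_degreeLT] at hp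
    exact Polynomial.eq_zero_of_degree_lt_of_eval_index_eq_zero S hv.injOn
      (hp.trans_le (by exact_mod_cast hS)) h0
  refine ⟨(Polynomial.degreeLT F K).map f, ?_, ?_⟩
  · have hinj : Function.Injective (f.domRestrict (Polynomial.degreeLT F K)) := by
      rw [← LinearMap.ker_eq_bot, LinearMap.ker_eq_bot']
      intro p hp
      exact Subtype.ext (hf p p.2 univ (by simpa using hKN) fun i _ => congrFun hp i)
    rw [← LinearMap.range_domRestrict, LinearMap.finrank_range_of_inj hinj,
      (Polynomial.degreeLTEquiv F K).finrank_eq, Module.finrank_fin_fun]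
  · rintro c ⟨p, hp, rfl⟩ S hS h0
    rw [hf p hp S hS h0, map_zero]

section Blocks

variable {N K : ℕ}

/-- The packet that carries the `j`-th message block of row `s` in the clear. -/
def blockPacket (hKN : K ≤ N) (s : Fin N) (j : Fin K) : Fin N := s + Fin.castLE hKN j

theorem blockPacket_injective (hKN : K ≤ N) (s : Fin N) :
    Function.Injective (blockPacket hKN s) :=
  (add_right_injective s).comp (Fin.castLE_injective hKN)

/-- If every message block can be read off its packet, then undetermined packets account for the
same fraction of undetermined message symbols. -/
theorem isErasureCode_of_blocks (hKN : K ≤ N) {α β P : Type*} [Fintype β] {T e : ℕ}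
    (enc : (Fin N × Fin K → β → α) → Fin N → P)
    (hclose : ∀ x x', (diffSet (enc x) (enc x')).card ≤ T → x = x')
    (hloc : ∀ x x' s j, enc x (blockPacket hKN s j) = enc x' (blockPacket hKN s j) →
      x (s, j) = x' (s, j))
    (hE : ∀ (y : Fin N → P) (E : Finset (Fin N)), (∀ i ∈ E, ∃ x x',
      (diffSet (enc x) y).card ≤ T ∧ (diffSet (enc x') y).card ≤ T ∧ enc x i ≠ enc x' i) →
      E.card ≤ e) :
    IsErasureCode (fun (x : (Fin N × Fin K) × β → α) => enc fun p b => x (p, b)) T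
      (K * e * Fintype.card β) := by
  classical
  refine ⟨fun x x' hx => ?_, fun y => ?_⟩
  · have := hclose _ _ hx
    funext p
    exact congrFun (congrFun this p.1) p.2
  · let E : Finset (Fin N) := univ.filter fun i => ∃ x x',
      (diffSet (enc x) y).card ≤ T ∧ (diffSet (enc x') y).card ≤ T ∧ enc x i ≠ enc x' i
    have hEe := hE y E fun i hi => (mem_filter.1 hi).2
    -- For fixed `j`, the shift by `s` visits each packet once. Every packet therefore shows exactly
    -- `K` blocks in the clear, and one bad packet costs `K` blocks out of `N * K`.
    let g : (Fin N × Fin K) × β → (Fin K × Fin N) × β :=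
      fun q => ((q.1.2, blockPacket hKN q.1.1 q.1.2), q.2)
    have hg : Function.Injective g := by
      rintro ⟨⟨s, j⟩, b⟩ ⟨⟨s', j'⟩, b'⟩ h
      simp only [g, Prod.mk.injEq, blockPacket] at h
      obtain ⟨⟨rfl, h⟩, rfl⟩ := h
      rw [add_left_injective _ h]
    have hle := card_le_card_of_injOn (t := ((univ : Finset (Fin K)) ×ˢ E) ×ˢ (univ : Finset β)) g
      (s := ambiguous (fun (x : (Fin N × Fin K) × β → α) => enc fun p b => x (p, b)) T y) (by
      rintro ⟨⟨s, j⟩, b⟩ hq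
      obtain ⟨x, x', h1, h2, h3⟩ := mem_ambiguous.1 hq
      simp only [g, coe_product, Set.mem_prod, mem_coe, mem_univ, true_and, and_true, E,
        mem_filter]
      exact ⟨_, _, h1, h2, fun h => h3 (congrFun (hloc _ _ s j h) b)⟩) hg.injOn
    refine hle.trans ?_
    rw [card_product, card_product, card_univ, card_univ, Fintype.card_fin]
    gcongr

end Blocks

/-- Words of length `b` embed in a power of a finite set with barely more elements. -/
theorem exists_block_embeddings (α F : Type*) [Fintype α] [Fintype F] (hα : 2 ≤ Fintype.card α)
    (hF : 2 ≤ Fintype.card F) (b₀ : ℕ) : ∃ b r : ℕ, b₀ ≤ b ∧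
      Nonempty ((Fin b → α) ↪ (Fin r → F)) ∧ Nonempty ((Fin r → F) ↪ (Fin (b + 1) → α)) := by
  set A := Fintype.card α
  set q := Fintype.card F
  set r := A ^ b₀
  have hr : A ^ b₀ ≤ q ^ r := (Nat.lt_pow_self hF).le
  have hne : q ^ r ≠ 0 := by positivity
  -- With this `b`, `A ^ b ≤ q ^ r < A ^ (b + 1)`: changing alphabets wastes a single symbol per
  -- block.
  refine ⟨Nat.log A (q ^ r), r, Nat.le_log_of_pow_le hα hr, ?_, ?_⟩
  · rw [Function.Embedding.nonempty_iff_card_le]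
    simpa using Nat.pow_log_le_self A hne
  · rw [Function.Embedding.nonempty_iff_card_le]
    simpa using (Nat.lt_pow_succ_log_self hα (q ^ r)).le

/-- Interleaved systematic MDS codes. -/
theorem attains_of_isMDS {F : Type*} [Field F] [Fintype F] {α : Type*} [Fintype α]
    (hα : 2 ≤ Fintype.card α) {N K T e : ℕ} (hK : 0 < K) (hKT : K + T ≤ N)
    {C : Submodule F (Fin N → F)} (h : IsMDS C K)
    (hlist : ∀ (τ : Type) (y : Fin N → τ → F) (E : Finset (Fin N)),
      (∀ i ∈ E, ∃ c c' : Fin N → τ → F, (∀ t, (fun i => c i t) ∈ C) ∧ (∀ t, (fun i => c' i t) ∈ C) ∧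
        (diffSet c y).card ≤ T ∧ (diffSet c' y).card ≤ T ∧ c i ≠ c' i) → E.card ≤ e) :
    Attains α N T (1 / K) (e / N) := by
  classical
  intro ε hε
  have hKN : K ≤ N := by omega
  obtain ⟨b₀, hb₀⟩ := exists_nat_ge (1 / ε)
  obtain ⟨b, r, hb, ⟨φ⟩, ⟨ψ⟩⟩ := exists_block_embeddings α F hα Fintype.one_lt_card (b₀ + 1)
  choose S hSC hS using fun s => h.exists_systematic (blockPacket_injective hKN s)
  let enc : (Fin N × Fin K → Fin b → α) → Fin N → (Fin N × Fin r → F) :=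
    fun x i q => S q.1 (fun j => φ (x (q.1, j)) q.2) i
  have hencC : ∀ x q, (fun i => enc x i q) ∈ C := fun x q => hSC _ _
  have hloc : ∀ x x' s j, enc x (blockPacket hKN s j) = enc x' (blockPacket hKN s j) →
      x (s, j) = x' (s, j) := by
    intro x x' s j heq
    refine φ.injective (funext fun t => ?_)
    simpa [enc, hS] using congrFun heq (s, t)
  have hcode := isErasureCode_of_blocks (T := T) (e := e) hKN enc (by
    intro x x' hx
    have henc : enc x = enc x' := by
      funext i q
      have hcard := card_compl_add_card (diffSet (enc x) (enc x'))
      rw [Fintype.card_fin] at hcard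
      refine congrFun (h.eq_of_agree (hencC x q) (hencC x' q)
        (S := (diffSet (enc x) (enc x'))ᶜ) (by omega) fun i hi => ?_) i
      rw [mem_compl, mem_diffSet, not_not] at hi
      exact congrFun hi q
    funext p
    exact hloc x x' p.1 p.2 (by rw [henc])) hloc (by
    intro y E hE
    refine hlist _ y E fun i hi => ?_
    obtain ⟨x, x', h1, h2, h3⟩ := hE i hi
    exact ⟨_, _, hencC x, hencC x', h1, h2, h3⟩)
  have hψ : Function.Injective fun (p : Fin N × Fin r → F) (q : Fin N × Fin (b + 1)) =>
      ψ (fun t => p (q.1, t)) q.2 := by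
    intro p p' hp
    funext q
    have : (fun t => p (q.1, t)) = fun t => p' (q.1, t) :=
      ψ.injective (funext fun l => congrFun hp (q.1, l))
    exact congrFun this q.2
  have hsch := hcode.hasScheme hψ.injOn (k := N * K * b) (len := N * (b + 1)) (by simp) (by simp)
  have hN : 0 < N := by omega
  have hb1 : 1 ≤ b := by omega
  refine ⟨_, _, _, by positivity, hsch, ?_, ?_⟩
  · have hbε : 1 ≤ ε * (K * b) := by
      have h1 : 1 / ε ≤ b := hb₀.trans (by exact_mod_cast (by omega : b₀ ≤ b))
      rw [div_le_iff₀ hε] at h1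
      have h2 : (1 : ℝ) ≤ K := by exact_mod_cast hK
      have h3 : (0 : ℝ) ≤ ε * b := by positivity
      nlinarith
    have : (1 / (K : ℝ) + ε) * (N * K * b : ℕ) = N * b + N * (ε * (K * b)) := by
      push_cast; field_simp
    rw [this]
    push_cast
    have hN0 : (0 : ℝ) ≤ N := by positivity
    nlinarith
  · have : ((e : ℝ) / N + ε) * (N * K * b : ℕ) = K * e * b + ε * (N * K * b) := by
      push_cast; field_simp
    rw [this]
    simp only [Fintype.card_fin]
    push_cast
    have : 0 ≤ ε * (N * K * b : ℝ) := by positivity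
    linarith

/-- Lossless correction of `T` errors. -/
theorem attains_unique_decoding {α : Type*} [Fintype α] (hα : 2 ≤ Fintype.card α) {N T : ℕ}
    (hN : 2 * T < N) : Attains α N T (1 / ((N : ℝ) - 2 * T)) 0 := by
  obtain ⟨p, hpN, hp⟩ := Nat.exists_infinite_primes N
  have := Fact.mk hp
  obtain ⟨C, hC⟩ := exists_isMDS (F := ZMod p) (N := N) (K := N - 2 * T) (by omega)
    (v := fun i => (i.val : ZMod p)) (by
      intro i j hij
      have h1 := (ZMod.natCast_eq_natCast_iff' _ _ _).1 hij
      rw [Nat.mod_eq_of_lt (i.2.trans_le hpN), Nat.mod_eq_of_lt (j.2.trans_le hpN)] at h1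
      exact Fin.ext h1)
  have h := attains_of_isMDS (e := 0) hα (T := T) (by omega) (by omega) hC (by
    classical
    intro τ y E hE
    rw [Nat.le_zero, card_eq_zero]
    refine eq_empty_of_forall_notMem fun i hi => ?_
    obtain ⟨c, c', hc, hc', h1, h2, h3⟩ := hE i hi
    refine h3 (funext fun t => congrFun (hC.eq_of_agree (hc t) (hc' t)
      (S := (diffSet c y ∪ diffSet c' y)ᶜ) ?_ fun l hl => ?_) i)
    · rw [card_compl, Fintype.card_fin]
      have := card_union_le (diffSet c y) (diffSet c' y)
      omega
    · simp only [mem_compl, mem_union, mem_diffSet, not_or, not_not] at hl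
      rw [hl.1, hl.2])
  rw [Nat.cast_sub hN.le] at h
  simpa using h

/-- List decoding of `L`-MDS codes. -/
theorem attains_list_decoding {F : Type*} [Field F] [Fintype F] [DecidableEq F]
    {α : Type*} [Fintype α] (hα : 2 ≤ Fintype.card α) {N T K L : ℕ}
    {C : Submodule F (Fin N → F)} (h : IsLMDS C K L) (hK : 0 < K) (hLK : L ≤ K)
    (hKT : K + T ≤ N) (hL : 1 ≤ L) (hT : L * (K + T) + T = L * N) :
    Attains α N T (1 / K) ((L * T : ℕ) / N) := by
  classical
  refine attains_of_isMDS hα hK hKT (h.isMDS (by omega)) fun τ y E hE => ?_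
  choose! c c' hc hc' h1 h2 h3 using hE
  let W : Finset (Fin N → τ → F) := E.image c ∪ E.image c'
  have hWC : ∀ d ∈ W, ∀ t, (fun i => d i t) ∈ C := by
    intro d hd
    rcases mem_union.1 hd with hd | hd <;> obtain ⟨i, hi, rfl⟩ := mem_image.1 hd
    exacts [hc i hi, hc' i hi]
  have hWT : ∀ d ∈ W, (diffSet d y).card ≤ T := by
    intro d hd
    rcases mem_union.1 hd with hd | hd <;> obtain ⟨i, hi, rfl⟩ := mem_image.1 hd
    exacts [h1 i hi, h2 i hi]
  -- By `hT`, `L + 1` candidates with at least `N - T` agreements each would reach equality in a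
  -- bound that is strict.
  have hWL : W.card ≤ L := by
    by_contra! hlt
    obtain ⟨W', hW', hcard⟩ := exists_subset_card_eq (show L + 1 ≤ W.card by omega)
    have hlt := h.interleaved_sum_card_lt (by omega) hLK y (L + 1) W'
      (fun d hd => hWC d (hW' hd)) hcard (by omega) le_rfl (fun d => (diffSet d y)ᶜ) (by
        intro d _ i hi
        rwa [mem_compl, mem_diffSet, not_not] at hi)
    have hge : ∑ d ∈ W', (N - T) ≤ ∑ d ∈ W', ((diffSet d y)ᶜ).card := by
      refine sum_le_sum fun d hd => ?_
      rw [card_compl, Fintype.card_fin]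
      have := hWT d (hW' hd)
      omega
    rw [sum_const, hcard, smul_eq_mul] at hge
    have hU : (W'.biUnion fun d => (diffSet d y)ᶜ).card ≤ N := by
      simpa using card_le_univ (W'.biUnion fun d => (diffSet d y)ᶜ)
    obtain ⟨M, rfl⟩ := Nat.exists_eq_add_of_le (show T ≤ N by omega)
    rw [Nat.add_sub_cancel_left] at hge
    nlinarith
  have hsub : E ⊆ W.biUnion fun d => diffSet d y := by
    intro i hi
    by_contra hn
    simp only [mem_biUnion, mem_diffSet, not_exists, not_and, not_not] at hn
    exact h3 i hi ((hn _ (mem_union_left _ (mem_image_of_mem c hi))).trans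
      (hn _ (mem_union_right _ (mem_image_of_mem c' hi))).symm)
  calc E.card ≤ (W.biUnion fun d => diffSet d y).card := card_le_card hsub
    _ ≤ W.card * T := card_biUnion_le_card_mul _ _ _ hWT
    _ ≤ L * T := by gcongr

/-! ### Polytope codes -/

/-- A vector is determined by its norm and its inner products with vectors whose span contains
the true one. -/
theorem eq_of_inner_eq {n q : Type*} [Fintype q] (S : Finset n) (a : n → ℚ) (X : n → q → ℤ)
    (u : n) (y : q → ℤ) (hX : ∀ t, (X u t : ℚ) = ∑ j ∈ S, a j * X j t)
    (hnorm : ∑ t, y t * y t = ∑ t, X u t * X u t)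
    (hdot : ∀ j ∈ S, ∑ t, y t * X j t = ∑ t, X u t * X j t) : X u = y := by
  have hdot' : ∀ j ∈ S, ∑ t, ((y t : ℚ) - X u t) * X j t = 0 := by
    intro j hj
    have := hdot j hj
    rw [← sub_eq_zero, ← sum_sub_distrib] at this
    have h' : ((∑ t, (y t * X j t - X u t * X j t) : ℤ) : ℚ) = 0 := by rw [this]; simp
    push_cast at h'
    rw [← h']
    exact sum_congr rfl fun t _ => by ring
  -- The error `y - X u` is orthogonal to the span, hence to `X u`. With equal norms its own squared
  -- norm then vanishes.
  have horth : ∑ t, ((y t : ℚ) - X u t) * X u t = 0 := by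
    calc ∑ t, ((y t : ℚ) - X u t) * X u t
        = ∑ t, ∑ j ∈ S, a j * (((y t : ℚ) - X u t) * X j t) := by
          refine sum_congr rfl fun t _ => ?_
          conv_lhs => rw [hX t, mul_sum, ← hX t]
          exact sum_congr rfl fun j _ => by ring
      _ = ∑ j ∈ S, a j * ∑ t, ((y t : ℚ) - X u t) * X j t := by
          rw [sum_comm]; simp only [mul_sum]
      _ = 0 := sum_eq_zero fun j hj => by rw [hdot' j hj, mul_zero]
  have hnorm' : ∑ t, ((y t : ℚ) * y t) = ∑ t, (X u t : ℚ) * X u t := by exact_mod_cast hnorm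
  have hsq : ∑ t, ((y t : ℚ) - X u t) ^ 2 = 0 := by
    have : ∑ t, ((y t : ℚ) - X u t) ^ 2 = ∑ t, ((y t : ℚ) * y t) - ∑ t, (X u t : ℚ) * X u t
        - 2 * ∑ t, ((y t : ℚ) - X u t) * X u t := by
      rw [mul_sum, ← sum_sub_distrib, ← sum_sub_distrib]
      exact sum_congr rfl fun t _ => by ring
    rw [this, hnorm', horth]; ring
  rw [sum_eq_zero_iff_of_nonneg fun t _ => sq_nonneg _] at hsq
  funext t
  have := pow_eq_zero_iff two_ne_zero |>.1 (hsq t (mem_univ _))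
  exact_mod_cast (sub_eq_zero.1 this).symm

/-- The inner products of the packets. -/
def gram {n q : Type*} [Fintype q] (X : n → q → ℤ) (p : n × n) : ℤ := ∑ t, X p.1 t * X p.2 t

theorem gram_swap {n q : Type*} [Fintype q] (X : n → q → ℤ) (i j : n) :
    gram X (i, j) = gram X (j, i) :=
  sum_congr rfl fun _ _ => mul_comm _ _

/-- Two vertices are incompatible if the received vectors do not have the inner products that the
Gram matrix prescribes. -/
def Incompatible {n q : Type*} [Fintype q] (v : n → q → ℤ) (G : n × n → ℤ) (i j : n) : Prop :=
  ¬ (gram v (i, j) = G (i, j) ∧ gram v (i, i) = G (i, i) ∧ gram v (j, j) = G (j, j))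

/-- Two correct vectors are always compatible, so errors cover all edges. If an erroneous vertex had
too few neighbours outside the error set, at least `K` correct vectors would be compatible with it;
these span its true value, and the Gram data would force it to be correct. -/
theorem isTightCover_diffSet {q : Type*} [Fintype q] {N K T : ℕ} (hK : 0 < K)
    (hKT : K + T = N) {C : Submodule ℚ (Fin N → ℚ)} (hC : IsMDS C K) (X v : Fin N → q → ℤ)
    (hX : ∀ t, (fun i => (X i t : ℚ)) ∈ C) (hcard : (diffSet X v).card ≤ T) :
    IsTightCover (Incompatible v (gram X)) T (diffSet X v) := by
  classical
  refine ⟨hcard, fun i j hij => ?_, fun u hu => ?_⟩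
  · by_contra! hno
    simp only [mem_diffSet, not_not] at hno
    exact hij (by simp [gram, hno.1, hno.2])
  · by_contra! hle
    set S := (diffSet X v ∪ nbrsOutside (Incompatible v (gram X)) (diffSet X v) u)ᶜ with hS
    have hScard : K ≤ S.card := by
      have := card_union_le (diffSet X v) (nbrsOutside (Incompatible v (gram X)) (diffSet X v) u)
      rw [hS, card_compl, Fintype.card_fin]
      omega
    have hSmem : ∀ j ∈ S, X j = v j ∧ gram v (u, j) = gram X (u, j) ∧
        gram v (u, u) = gram X (u, u) := by
      intro j hj
      simp only [hS, mem_compl, mem_union, not_or, mem_nbrsOutside, not_and] at hj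
      have h1 := hj.2 hj.1
      simp only [Incompatible, not_not] at h1
      exact ⟨by simpa [mem_diffSet] using hj.1, h1.1, h1.2.1⟩
    obtain ⟨a, ha⟩ := hC.exists_coeff hScard u
    -- Compatibility includes the norms of both endpoints, so a single compatible vertex certifies
    -- the norm of `v u`.
    obtain ⟨j₀, hj₀⟩ := card_pos.1 (hK.trans_le hScard)
    refine mem_diffSet.1 hu (eq_of_inner_eq S a X u (v u) (fun t => ha _ (hX t))
      (hSmem j₀ hj₀).2.2 fun j hj => ?_)
    have := (hSmem j hj).2.1
    simp only [gram, ← (hSmem j hj).1] at this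
    exact this

theorem exists_int_embedding (α : Type*) [Fintype α] (B g : ℕ)
    (h : 2 * B + 1 ≤ Fintype.card α ^ g) :
    ∃ θ : ℤ → Fin g → α, Set.InjOn θ {z | |z| ≤ B} := by
  classical
  have hne : Nonempty (Icc (-(B : ℤ)) B ↪ (Fin g → α)) := by
    rw [Function.Embedding.nonempty_iff_card_le]
    simp only [Fintype.card_coe, Int.card_Icc, Fintype.card_fun, Fintype.card_fin]
    omega
  obtain ⟨f⟩ := hne
  have h0 : (0 : ℤ) ∈ Icc (-(B : ℤ)) B := by simp
  refine ⟨fun z => if hz : z ∈ Icc (-(B : ℤ)) B then f ⟨z, hz⟩ else f ⟨0, h0⟩, ?_⟩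
  intro z hz z' hz' heq
  have h1 : z ∈ Icc (-(B : ℤ)) B := mem_Icc.2 (abs_le.1 hz)
  have h2 : z' ∈ Icc (-(B : ℤ)) B := mem_Icc.2 (abs_le.1 hz')
  simp only [dif_pos h1, dif_pos h2] at heq
  exact congrArg Subtype.val (f.injective heq)

/-- Rational systematic encoders become integral after clearing denominators. -/
theorem exists_integral_encoders {N K : ℕ} {C : Submodule ℚ (Fin N → ℚ)} (hC : IsMDS C K)
    (hKN : K ≤ N) : ∃ (d : ℤ) (Z : Fin N → Fin N → Fin K → ℤ), d ≠ 0 ∧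
      (∀ s (u : Fin K → ℤ), (fun i => ((∑ j, Z s i j * u j : ℤ) : ℚ)) ∈ C) ∧
      ∀ s (u : Fin K → ℤ) j, ∑ l, Z s (blockPacket hKN s j) l * u l = d * u j := by
  choose S hSC hS using fun s => hC.exists_systematic (blockPacket_injective hKN s)
  let σ : Fin N × Fin N × Fin K → ℚ := fun p => S p.1 (fun l => if p.2.2 = l then 1 else 0) p.2.1
  obtain ⟨d, hd⟩ := IsLocalization.exist_integer_multiples_of_finite (nonZeroDivisors ℤ) σ
  choose Z hZ using hd
  have hZ' : ∀ s i j, (Z (s, i, j) : ℚ) = (d : ℤ) * σ (s, i, j) := by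
    intro s i j
    have := hZ (s, i, j)
    simpa using this
  have key : ∀ s (u : Fin K → ℤ) i, ((∑ j, Z (s, i, j) * u j : ℤ) : ℚ) =
      (d : ℤ) * S s (fun j => (u j : ℚ)) i := by
    intro s u i
    rw [LinearMap.pi_apply_eq_sum_univ (S s)]
    simp only [Finset.sum_apply, Pi.smul_apply, smul_eq_mul, mul_sum]
    push_cast
    refine sum_congr rfl fun j _ => ?_
    rw [hZ']
    simp only [σ]
    ring
  refine ⟨d, fun s i j => Z (s, i, j), nonZeroDivisors.coe_ne_zero d, fun s u => ?_, fun s u j => ?_⟩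
  · have : (fun i => ((∑ j, Z (s, i, j) * u j : ℤ) : ℚ)) =
        ((d : ℤ) : ℚ) • S s (fun j => (u j : ℚ)) := by
      funext i; rw [key]; simp
    rw [this]
    exact C.smul_mem _ (hSC s _)
  · have := key s u (blockPacket hKN s j)
    rw [hS] at this
    exact_mod_cast this

theorem exists_exp_ge_linear (a c δ : ℝ) (ha : 0 ≤ a) (hc : 0 ≤ c) (hδ : 0 < δ) :
    ∃ w : ℕ, a * w + c ≤ δ * 2 ^ w := by
  obtain ⟨v, hv⟩ := exists_nat_ge ((2 * a + c) / δ)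
  rw [div_le_iff₀ hδ] at hv
  -- An even exponent makes the power at least `(v + 1) ^ 2`, which outgrows the linear side.
  refine ⟨2 * v, ?_⟩
  have h1 : ((v : ℝ) + 1) ≤ 2 ^ v := by exact_mod_cast Nat.lt_two_pow_self (n := v)
  have h2 : ((v : ℝ) + 1) ^ 2 ≤ 2 ^ (2 * v) := by
    rw [mul_comm 2 v, pow_mul]; gcongr
  have h3 : δ * ((v : ℝ) + 1) ^ 2 ≤ δ * 2 ^ (2 * v) := by gcongr
  refine le_trans ?_ h3
  push_cast
  have hv0 : (0 : ℝ) ≤ v := by positivity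
  nlinarith [mul_nonneg hc hv0, mul_nonneg ha hv0]

/-- Packets that consist of the coordinates of an integral MDS code and of the Gram matrix. -/
theorem isErasureCode_polytope {α β q : Type*} [Fintype β] [Fintype q] {N K T : ℕ}
    (hN : 2 * T < N) (hKT : K + T = N) (hKN : K ≤ N) {C : Submodule ℚ (Fin N → ℚ)}
    (hC : IsMDS C K) (vec : (Fin N × Fin K → β → α) → Fin N → q → ℤ)
    (hvecC : ∀ x t, (fun i => (vec x i t : ℚ)) ∈ C)
    (hvecloc : ∀ x x' s j, vec x (blockPacket hKN s j) = vec x' (blockPacket hKN s j) →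
      x (s, j) = x' (s, j)) :
    IsErasureCode (fun (x : (Fin N × Fin K) × β → α) i =>
      (vec (fun p b => x (p, b)) i, gram (vec fun p b => x (p, b)))) T
      (K * polytopeF T * Fintype.card β) := by
  classical
  let enc : (Fin N × Fin K → β → α) → Fin N → (q → ℤ) × (Fin N × Fin N → ℤ) :=
    fun x i => (vec x i, gram (vec x))
  have hsubdiff : ∀ x y, diffSet (vec x) (fun i => (y i).1) ⊆ diffSet (enc x) y := by
    intro x y i
    simp only [mem_diffSet]
    exact fun h h' => h (by rw [← h'])
  refine isErasureCode_of_blocks (T := T) (e := polytopeF T) hKN enc ?_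
    (fun x x' s j heq => hvecloc x x' s j (congrArg Prod.fst heq)) ?_
  · intro x x' hx
    have hvec : vec x = vec x' := by
      funext i t
      have hcard := card_compl_add_card (diffSet (enc x) (enc x'))
      rw [Fintype.card_fin] at hcard
      have := congrFun (hC.eq_of_agree (hvecC x t) (hvecC x' t)
        (S := (diffSet (enc x) (enc x'))ᶜ) (by omega) fun i hi => by
          rw [mem_compl, mem_diffSet, not_not] at hi
          exact congrArg (fun z : ℤ => (z : ℚ)) (congrFun (congrArg Prod.fst hi) t)) i
      exact_mod_cast this
    funext p
    exact hvecloc x x' p.1 p.2 (by rw [hvec])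
  · intro y E hE
    rcases E.eq_empty_or_nonempty with rfl | ⟨i₀, hi₀⟩
    · simp
    obtain ⟨x₀, -, hx₀, -, -⟩ := hE i₀ hi₀
    have hgram : ∀ x, (diffSet (enc x) y).card ≤ T → gram (vec x) = gram (vec x₀) := by
      intro x hx
      have hpos : 0 < (diffSet (enc x) y ∪ diffSet (enc x₀) y)ᶜ.card := by
        have := card_union_le (diffSet (enc x) y) (diffSet (enc x₀) y)
        rw [card_compl, Fintype.card_fin]
        omega
      obtain ⟨i, hi⟩ := card_pos.1 hpos
      simp only [mem_compl, mem_union, mem_diffSet, not_or, not_not] at hi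
      exact (congrArg Prod.snd hi.1).trans (congrArg Prod.snd hi.2).symm
    have hcov : ∀ x, (diffSet (enc x) y).card ≤ T →
        IsTightCover (Incompatible (fun i => (y i).1) (gram (vec x₀))) T
          (diffSet (vec x) fun i => (y i).1) := by
      intro x hx
      rw [← hgram x hx]
      exact isTightCover_diffSet (by omega) hKT hC _ _ (hvecC x)
        ((card_le_card (hsubdiff x y)).trans hx)
    refine card_tightCovers_le (Γ := Incompatible (fun i => (y i).1) (gram (vec x₀))) ?_ E
      fun i hi => ?_
    · intro u v huv h
      exact huv ⟨by rw [gram_swap, h.1, gram_swap], h.2.2, h.2.1⟩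
    · obtain ⟨x, x', h1, h2, h3⟩ := hE i hi
      -- The Gram parts coincide, so the two candidates differ in their vectors and at least one of
      -- them contradicts the received vector at `i`.
      by_cases hxi : vec x i = (y i).1
      · refine ⟨_, hcov x' h2, mem_diffSet.2 fun h => h3 (Prod.ext (hxi.trans h.symm) ?_)⟩
        exact (hgram x h1).trans (hgram x' h2).symm
      · exact ⟨_, hcov x h1, mem_diffSet.2 hxi⟩

theorem hasScheme_polytope {α β q : Type*} [Fintype α] [Fintype β] [Fintype q] {N K T : ℕ}
    (hN : 2 * T < N) (hKT : K + T = N) (hKN : K ≤ N) {C : Submodule ℚ (Fin N → ℚ)}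
    (hC : IsMDS C K) (vec : (Fin N × Fin K → β → α) → Fin N → q → ℤ)
    (hvecC : ∀ x t, (fun i => (vec x i t : ℚ)) ∈ C)
    (hvecloc : ∀ x x' s j, vec x (blockPacket hKN s j) = vec x' (blockPacket hKN s j) →
      x (s, j) = x' (s, j)) (B g₁ g₂ : ℕ) (hB : ∀ x i t, |vec x i t| ≤ B)
    (hg₁ : 2 * B + 1 ≤ Fintype.card α ^ g₁)
    (hg₂ : 2 * (Fintype.card q * B ^ 2) + 1 ≤ Fintype.card α ^ g₂) :
    HasScheme α N T (N * K * Fintype.card β) (Fintype.card q * g₁ + N * N * g₂)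
      (K * polytopeF T * Fintype.card β) := by
  have hgram : ∀ x p, |gram (vec x) p| ≤ (Fintype.card q * B ^ 2 : ℕ) := by
    intro x p
    calc |gram (vec x) p| ≤ ∑ t, |vec x p.1 t * vec x p.2 t| := abs_sum_le_sum_abs _ _
      _ ≤ ∑ t : q, (B : ℤ) * B := by
          refine sum_le_sum fun t _ => ?_
          rw [abs_mul]
          exact mul_le_mul (hB _ _ _) (hB _ _ _) (abs_nonneg _) (by positivity)
      _ = (Fintype.card q * B ^ 2 : ℕ) := by
          rw [sum_const, card_univ, nsmul_eq_mul]
          push_cast; ring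
  obtain ⟨θ₁, hθ₁⟩ := exists_int_embedding α B g₁ hg₁
  obtain ⟨θ₂, hθ₂⟩ := exists_int_embedding α _ g₂ hg₂
  let ψ : (q → ℤ) × (Fin N × Fin N → ℤ) →
      (q × Fin g₁) ⊕ ((Fin N × Fin N) × Fin g₂) → α :=
    fun p => Sum.elim (fun r => θ₁ (p.1 r.1) r.2) (fun r => θ₂ (p.2 r.1) r.2)
  refine (isErasureCode_polytope hN hKT hKN hC vec hvecC hvecloc).hasScheme (ψ := ψ) ?_
    (by simp) (by simp)
  rintro _ ⟨x, i, rfl⟩ _ ⟨x', i', rfl⟩ heq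
  refine Prod.ext (funext fun t => ?_) (funext fun p => ?_)
  · have : θ₁ (vec (fun p b => x (p, b)) i t) = θ₁ (vec (fun p b => x' (p, b)) i' t) :=
      funext fun l => congrFun heq (Sum.inl (t, l))
    exact hθ₁ (hB _ _ _) (hB _ _ _) this
  · have : θ₂ (gram (vec fun p b => x (p, b)) p) = θ₂ (gram (vec fun p b => x' (p, b)) p) :=
      funext fun l => congrFun heq (Sum.inr (p, l))
    exact hθ₂ (hgram _ _) (hgram _ _) this

theorem exists_hasScheme_polytope {α : Type*} [Fintype α] (hα : 2 ≤ Fintype.card α) {N K T : ℕ}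
    (hN : 2 * T < N) (hKT : K + T = N) : ∃ h₁ h₂ : ℕ, ∀ b w : ℕ,
      HasScheme α N T (N * K * (Fintype.card α ^ w * b))
        (N * Fintype.card α ^ w * (b + h₁) + N * N * (w + 2 * b + h₂))
        (K * polytopeF T * (Fintype.card α ^ w * b)) := by
  classical
  have hKN : K ≤ N := by omega
  set A := Fintype.card α with hA
  obtain ⟨C, hC⟩ := exists_isMDS (F := ℚ) hKN (v := fun i => (i.val : ℚ))
    (fun i j hij => Fin.ext (Nat.cast_injective hij))
  obtain ⟨d, Z, hd, hZC, hZloc⟩ := exists_integral_encoders hC hKN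
  let c : ℕ := ∑ s, ∑ i, ∑ j, (Z s i j).natAbs
  -- Coordinates are at most `c * A ^ b` and Gram entries at most `N * A ^ w * (c * A ^ b) ^ 2` in
  -- absolute value. The constant factors cost a bounded number of extra symbols, estimated crudely
  -- by `x ≤ A ^ x`.
  refine ⟨2 * c + 1, 2 * N * c ^ 2 + 1, fun b w => ?_⟩
  let m := A ^ w
  let ν : (Fin b → α) ≃ Fin (A ^ b) := Fintype.equivFinOfCardEq (by simp [hA])
  let vec : (Fin N × Fin K → Fin m × Fin b → α) → Fin N → Fin N × Fin m → ℤ :=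
    fun x i q => ∑ j, Z q.1 i j * ((ν fun l => x (q.1, j) (q.2, l)).val : ℤ)
  have hvecC : ∀ x q, (fun i => (vec x i q : ℚ)) ∈ C := fun x q => hZC _ _
  have hvecloc : ∀ x x' s j, vec x (blockPacket hKN s j) = vec x' (blockPacket hKN s j) →
      x (s, j) = x' (s, j) := by
    intro x x' s j heq
    funext p
    have h1 := congrFun heq (s, p.1)
    simp only [vec, hZloc s (fun j => ((ν fun l => _).val : ℤ))] at h1
    have h2 := ν.injective (Fin.ext (by exact_mod_cast mul_left_cancel₀ hd h1))
    exact congrFun h2 p.2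
  have hvecbd : ∀ x i q, |vec x i q| ≤ (c * A ^ b : ℕ) := by
    intro x i q
    have hcle : ∑ j, (Z q.1 i j).natAbs ≤ c :=
      (single_le_sum (f := fun i => ∑ j, (Z q.1 i j).natAbs) (fun _ _ => Nat.zero_le _)
        (mem_univ i)).trans
      (single_le_sum (f := fun s => ∑ i, ∑ j, (Z s i j).natAbs) (fun _ _ => Nat.zero_le _)
        (mem_univ q.1))
    calc |vec x i q| ≤ ∑ j, |Z q.1 i j * ((ν fun l => x (q.1, j) (q.2, l)).val : ℤ)| :=
          abs_sum_le_sum_abs _ _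
      _ ≤ ∑ j, (((Z q.1 i j).natAbs * A ^ b : ℕ) : ℤ) := by
          refine sum_le_sum fun j _ => ?_
          rw [abs_mul, Nat.abs_cast, Nat.cast_mul, Int.natCast_natAbs]
          gcongr
          exact_mod_cast (Fin.is_lt _).le
      _ ≤ (c * A ^ b : ℕ) := by
          rw [← Nat.cast_sum, ← sum_mul]
          exact_mod_cast Nat.mul_le_mul_right _ hcle
  have hA1 : 1 ≤ A ^ b := Nat.one_le_pow _ _ (by omega)
  have hA2 : 1 ≤ A ^ (w + 2 * b) := Nat.one_le_pow _ _ (by omega)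
  have := hasScheme_polytope hN hKT hKN hC vec hvecC hvecloc (c * A ^ b) (b + (2 * c + 1))
    (w + 2 * b + (2 * N * c ^ 2 + 1)) hvecbd
    (by
      calc 2 * (c * A ^ b) + 1 ≤ A ^ b * (2 * c + 1) := by nlinarith
        _ ≤ A ^ b * A ^ (2 * c + 1) := by gcongr; exact (Nat.lt_pow_self hα).le
        _ = A ^ (b + (2 * c + 1)) := (pow_add _ _ _).symm)
    (by
      rw [Fintype.card_prod, Fintype.card_fin, Fintype.card_fin]
      calc 2 * (N * m * (c * A ^ b) ^ 2) + 1 = 2 * N * c ^ 2 * A ^ (w + 2 * b) + 1 := by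
            simp only [m]; ring
        _ ≤ A ^ (w + 2 * b) * (2 * N * c ^ 2 + 1) := by nlinarith
        _ ≤ A ^ (w + 2 * b) * A ^ (2 * N * c ^ 2 + 1) := by
            gcongr; exact (Nat.lt_pow_self hα).le
        _ = A ^ (w + 2 * b + (2 * N * c ^ 2 + 1)) := (pow_add _ _ _).symm)
  simpa only [Fintype.card_prod, Fintype.card_fin] using this

/-- Polytope codes. -/
theorem attains_polytope {α : Type*} [Fintype α] (hα : 2 ≤ Fintype.card α) {N T : ℕ}
    (hN : 2 * T < N) : Attains α N T (1 / ((N : ℝ) - T)) (polytopeF T / N) := by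
  intro ε hε
  obtain ⟨K, hKN'⟩ := Nat.exists_eq_add_of_le (show T ≤ N by omega)
  have hKT : K + T = N := by omega
  have hK : 0 < K := by omega
  obtain ⟨h₁, h₂, hsch⟩ := exists_hasScheme_polytope hα hN hKT
  obtain ⟨b₀, hb₀⟩ := exists_nat_ge (h₁ / (ε / 2))
  rw [div_le_iff₀ (by positivity)] at hb₀
  obtain ⟨b, hb⟩ : ∃ b, b = b₀ + 1 := ⟨_, rfl⟩
  -- A large `b` has made the overhead per coordinate small. With `b` fixed, a large `w` dilutes the
  -- Gram matrix, whose length is linear in `w`, over at least `2 ^ w` rows.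
  obtain ⟨w, hw⟩ := exists_exp_ge_linear N (N * (2 * b + h₂)) (ε / 2) (by positivity)
    (by positivity) (by positivity)
  have hm' : (2 : ℝ) ^ w ≤ (Fintype.card α ^ w : ℕ) := by
    push_cast
    gcongr
    exact_mod_cast hα
  have hsch := hsch b w
  have hm : 0 < Fintype.card α ^ w := by positivity
  generalize Fintype.card α ^ w = m at hm hm' hsch
  have hN0 : 0 < N := by omega
  have hb0 : 0 < b := by omega
  have hNT : (N : ℝ) - T = K := by rw [← hKT]; push_cast; ring
  refine ⟨_, _, _, by positivity, hsch, ?_, ?_⟩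
  · have hK1 : (1 : ℝ) ≤ K := by exact_mod_cast hK
    have hb1 : (1 : ℝ) ≤ b := by exact_mod_cast hb0
    have e1 : (h₁ : ℝ) ≤ ε / 2 * b := by
      refine hb₀.trans ?_
      rw [mul_comm]
      gcongr
      omega
    have e2 : (N : ℝ) * w + N * (2 * b + h₂) ≤ ε / 2 * (m * b) := by
      refine hw.trans ?_
      gcongr
      exact hm'.trans (le_mul_of_one_le_right (by positivity) hb1)
    have e3 : (m : ℝ) * h₁ + N * (w + 2 * b + h₂) ≤ ε * (K * (m * b)) := by
      have h3 : (m : ℝ) * h₁ ≤ m * (ε / 2 * b) := by gcongr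
      have h4 : ε * (m * b) ≤ ε * (K * (m * b)) :=
        mul_le_mul_of_nonneg_left (le_mul_of_one_le_left (by positivity) hK1) hε.le
      linarith
    have e4 : (1 / ((N : ℝ) - T) + ε) * (N * K * (m * b) : ℕ) =
        N * (m * b) + N * (ε * (K * (m * b))) := by
      rw [hNT]; push_cast; field_simp
    rw [e4]
    push_cast
    have e5 : (N : ℝ) * (m * h₁ + N * (w + 2 * b + h₂)) ≤ N * (ε * (K * (m * b))) := by gcongr
    linarith
  · have : ((polytopeF T : ℝ) / N + ε) * (N * K * (m * b) : ℕ) =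
        K * polytopeF T * (m * b) + ε * (N * K * (m * b)) := by
      push_cast; field_simp
    rw [this]
    push_cast
    have : 0 ≤ ε * (N * K * (m * b) : ℝ) := by positivity
    linarith

end Codes

/-! ### Parameter inequalities and the three corners -/

theorem two_mul_lt_of_polytopeF_lt {N T : ℕ} (hN : polytopeF T + 1 ≤ N) : 2 * T < N := by
  unfold polytopeF at hN
  have : 4 * T ≤ T ^ 2 + 4 := by
    zify; nlinarith [sq_nonneg ((T : ℤ) - 2)]
  omega

/-- For L ≥ 3 the bound L²u ≤ N gives K ≥ (L² - L - 1)u ≥ L. For L = 2 it gives only K ≥ u, and the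
bound through F(T) takes over: K ≥ u² - u + 2. -/
theorem le_dim_of_polytopeF_lt {N L u K : ℕ} (hL : 2 ≤ L) (hu : 0 < u)
    (hN : polytopeF (L * u) + 1 ≤ N) (hLN : L * (L * u) ≤ N) (hK : K + L * u + u = N) :
    L ≤ K := by
  rcases hL.eq_or_lt with rfl | hL
  · unfold polytopeF at hN
    have h1 : (2 * u) ^ 2 / 4 = u ^ 2 := by
      rw [show (2 * u) ^ 2 = u ^ 2 * 4 by ring, Nat.mul_div_cancel _ (by norm_num)]
    rw [h1] at hN
    nlinarith
  · obtain ⟨l, rfl⟩ := Nat.exists_eq_add_of_le hL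
    obtain ⟨v, rfl⟩ := Nat.exists_eq_add_of_le hu
    simp only [Nat.succ_eq_add_one] at *
    nlinarith [Nat.zero_le (l * v), Nat.zero_le (l * l * v), Nat.zero_le (l * l)]

end VPEC

theorem corollary2 (N T L : ℕ) (hT : 0 < T) (hN : VPEC.polytopeF T + 1 ≤ N)
    (hL : 2 ≤ L) (hLN : (L : ℝ) ≤ (N : ℝ) / T) (hLT : L ∣ T)
    (ρ : ℝ) (hρ : ρ = 1 - (1 + 1 / (L : ℝ)) * ((T : ℝ) / N))
    (hMDS : ∃ (F : Type) (_ : Field F) (_ : Fintype F) (_ : DecidableEq F)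
      (C : Submodule F (Fin N → F)) (K : ℕ), (K : ℝ) = ρ * N ∧ VPEC.IsLMDS C K L)
    {α : Type*} [Fintype α] [DecidableEq α] (hα : 2 ≤ Fintype.card α)
    (R D : ℝ) (hR₁ : 1 / ((N : ℝ) - T) ≤ R) (hR₂ : R ≤ 1 / ((N : ℝ) - 2 * T)) :
    (R ≤ (ρ * N)⁻¹ →
      (1 - (T : ℝ) / N - ρ * ((N : ℝ) - T) * R) / ((N : ℝ) - T - ρ * N) * VPEC.polytopeF T
        + (ρ * ((N : ℝ) - T) * R - ρ) / ((N : ℝ) - T - ρ * N) * ((L : ℝ) * T) ≤ D →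
      VPEC.Achievable α N T R D) ∧
    ((ρ * N)⁻¹ < R →
      (ρ - ρ * ((N : ℝ) - 2 * T) * R) / (ρ * N - ((N : ℝ) - 2 * T)) * ((L : ℝ) * T) ≤ D →
      VPEC.Achievable α N T R D) := by
  obtain ⟨F, _, _, _, C, K, hKρ, hC⟩ := hMDS
  obtain ⟨u, rfl⟩ := hLT
  have : Nonempty α := Fintype.card_pos_iff.1 (by omega)
  have h2T := VPEC.two_mul_lt_of_polytopeF_lt hN
  have hu : 0 < u := Nat.pos_of_mul_pos_left hT
  have hLpos : (0 : ℝ) < L := by exact_mod_cast (by omega : 0 < L)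
  have hTpos : (0 : ℝ) < (L * u : ℕ) := by exact_mod_cast hT
  have hNpos : (0 : ℝ) < N := by exact_mod_cast (by omega : 0 < N)
  have huR : (0 : ℝ) < u := by exact_mod_cast hu
  have hLN' : L * (L * u) ≤ N := by
    rw [le_div_iff₀ hTpos] at hLN
    exact_mod_cast hLN
  have hKN : K + L * u + u = N := by
    have : (K : ℝ) + L * u + u = N := by
      rw [hKρ, hρ]; push_cast; field_simp; ring
    exact_mod_cast this
  have hLK := VPEC.le_dim_of_polytopeF_lt hL hu hN hLN' hKN
  have hA := VPEC.attains_polytope hα h2T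
  have hB := VPEC.attains_list_decoding hα hC (T := L * u) (by omega) hLK (by omega) (by omega)
    (by rw [← hKN]; ring)
  have hU := VPEC.attains_unique_decoding hα h2T
  have hKR : (0 : ℝ) < K := by exact_mod_cast (by omega : 0 < K)
  have hρK : ρ = K / N := by rw [hKρ]; field_simp
  have hNR : (N : ℝ) = K + L * u + u := by exact_mod_cast hKN.symm
  have h2TR : (0 : ℝ) < N - 2 * (L * u : ℕ) := by
    have : ((2 * (L * u) : ℕ) : ℝ) < N := by exact_mod_cast h2T
    push_cast at this ⊢; linarith
  have hTR : (0 : ℝ) < N - (L * u : ℕ) := by linarith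
  rw [← hKρ]
  constructor
  · intro hR hD
    -- The weight for which the mixture of the rates `1 / (N - T)` and `1 / K` is `R`; here `u = N -
    -- T - K`.
    set c : ℝ := (N - (L * u : ℕ)) * (1 - K * R) / u with hc
    have hRK : K * R ≤ 1 := by
      have := mul_le_mul_of_nonneg_left hR hKR.le
      rwa [mul_inv_cancel₀ hKR.ne'] at this
    have hR₁' : 1 ≤ R * (N - (L * u : ℕ)) := by rwa [div_le_iff₀ hTR] at hR₁
    have hmix := hA.convex hB (c := c) (by
      have : 0 ≤ 1 - K * R := by linarith
      positivity) (by
      rw [hc, div_le_one huR]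
      push_cast at *
      have e : (N : ℝ) - L * u = K + u := by linarith
      rw [e] at *
      nlinarith)
    have e : (N : ℝ) - (L * u : ℕ) = K + u := by push_cast; linarith
    have hKu : (0 : ℝ) < K + u := by positivity
    have eR : c * (1 / ((N : ℝ) - (L * u : ℕ))) + (1 - c) * (1 / K) = R := by
      rw [hc, e]; field_simp; ring
    rw [eR] at hmix
    refine (hmix.mono (le_trans (le_of_eq ?_) hD)).achievable hα
    have e' : ((L * u : ℕ) : ℝ) = N - K - u := by push_cast; linarith
    rw [hc, hρK, Nat.cast_mul L (L * u), e']
    have e2 : (N : ℝ) - (N - K - u) - K = u := by ring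
    rw [e2]
    field_simp
    ring
  · intro hR hD
    set c : ℝ := K * (1 - (N - 2 * (L * u : ℕ)) * R) / (K - (N - 2 * (L * u : ℕ))) with hc
    -- This difference equals `(L - 1) * u`, which is positive.
    have hden : (0 : ℝ) < K - (N - 2 * (L * u : ℕ)) := by
      have : (2 : ℝ) ≤ L := by exact_mod_cast hL
      push_cast; rw [hNR]; nlinarith
    have hRK : 1 ≤ K * R := by
      have := mul_le_mul_of_nonneg_left hR.le hKR.le
      rwa [mul_inv_cancel₀ hKR.ne'] at this
    have hR₂' : R * (N - 2 * (L * u : ℕ)) ≤ 1 := by rwa [le_div_iff₀ h2TR] at hR₂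
    have hmix := hB.convex hU (c := c) (by
      have : 0 ≤ 1 - (N - 2 * (L * u : ℕ)) * R := by linarith
      positivity) (by
      rw [hc, div_le_one hden]
      nlinarith)
    have eR : c * (1 / K) + (1 - c) * (1 / ((N : ℝ) - 2 * (L * u : ℕ))) = R := by
      rw [hc]; field_simp; ring
    rw [eR] at hmix
    refine (hmix.mono (le_trans (le_of_eq ?_) hD)).achievable hα
    rw [hc, hρK, Nat.cast_mul L (L * u)]
    field_simp
    ring
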